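/- Let $s \in \mathbb N_0$, let $\emptyset \ne \Omega \subset \mathbb C^s$ be finite with elements pairwise distinct modulo $2\pi i\mathbb Z^s$ (so that $\Omega$ is a finite subset of $(\mathbb R + i\mathbb T)^s = (\mathbb C/2\pi i\mathbb Z)^s$), let $f_\omega \in \mathbb C\setminus\{0\}$ for $\omega \in \Omega$, and let $f(x) = \sum_{\omega\in\Omega} f_\omega e^{\omega^T x}$. **Notation.** $\Pi = \mathbb C[z_1,\dots,z_s]$, $\deg$ is the total degree, $\Pi_k$ and $\Pi^0_k$ are the spaces of polynomials of degree at most $k$ and of forms of degree $k$, and $\Lambda(p)$ is the leading form of $p$, $r^0_k$ the homogeneous component of $r$ of degree $k$, and $(p,q) = \sum_\alpha p_\alpha \overline{q_\alpha}$. Put $z_\omega = (e^{\omega_1},\dots,e^{\omega_s})$ and $I_\Omega = \{p \in \Pi : p(z_\omega)=0,\ \omega\in\Omega\}$. A normal form of $p$ is an $r=\nu(p) \in \Pi$ with $p - r \in I_\Omega$, $\deg r \le \deg p$ and $(r_k^0,\Lambda(q)) = 0$ for all $k$ and all $q \in I_\Omega\cap\Pi_k$. Let $N = \nu(\Pi)$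 be the space of all normal forms and $\deg N = \max\{\deg r : r \in N\}$. A finite family $H\subset\Pi$ is an H-basis of $I_\Omega$ if $p \in I_\Omega$ holds exactly when $p = \sum_{h\in H} p_h h$ for some $p_h$ with $\deg p_h + \deg h \le \deg p$ for all $h$ with $p_h\neq0$. Polynomials are identified with their coefficient vectors, padded by zeros where needed. A *QR factorization* is a factorization $A = [Q_1,Q_2]\begin{bmatrix}R\\0\end{bmatrix}$ with $[Q_1,Q_2]$ unitary and $R$ square and upper triangular. **Algorithm** (input: $n$ and the samples $a(\alpha)$, $|\alpha|\le 2n$). Put $F_{n,k} = [a(\alpha+\beta)]_{|\alpha|\le n,\,|\beta|\le k}$. 1. Put $K_0=P_0=[\,]$ (no columns). For $k=0,1,\dots$, with $k+1 \le n$: choose a matrix $\tilde P_{k+1}$ whose columns are a basis of $\ker F_{n,k+1}$; with the Moore–Penrose inverse $\tilde P_{k+1}^+$ form $\tilde X=\tilde P_{k+1}^+\begin{bmatrix}K_k\\0\end{bmatrix}$ and a QR factorization of $\tilde X$ with factors $[Q_1,Q_2]$; put $P_{k+1}=\tilde P_{k+1}Q_2$ and $K_{k+1}=[P_0,\dots,P_{k+1}]$.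 Stop at the first $k=:m$ with $\operatorname{rank}F_{n,k}=\operatorname{rank}F_{n,k+1}$. 2. For $k=0,\dots,m+1$ let $\Lambda(P_k)$ be the matrix of the degree-$k$ parts of the columns of $P_k$; choose a QR factorization of $\Lambda(P_k)$, with factors $[Q_{k,1},Q_{k,2}]$ and $R_k$, and put $N_k=Q_{k,2}$. 3. For $j=1,\dots,s$ build the block matrix $M_j$, with blocks $(M_j)_{\ell,k}$, $0\le \ell,k\le m$, as follows. Write $C_\ell=R_\ell^{-1}Q_{\ell,1}^*$ and let $L_{k,j}:\Pi_k^0\to\Pi_{k+1}^0$ be the matrix of the multiplication by $z_j$. Then $(M_j)_{k+1,k}=N_{k+1}^*(I-\Lambda(P_{k+1})C_{k+1})L_{k,j}N_k$, $T_{k+1}=(\Lambda(P_{k+1})-P_{k+1})C_{k+1}L_{k,j}N_k$; for $\ell=k,k-1,\dots,0$, with $(T_{\ell+1})^0_\ell$ the part of degree $\ell$ of $T_{\ell+1}$, $(M_j)_{\ell,k}=N_\ell^*(I-\Lambda(P_\ell)C_\ell)(T_{\ell+1})^0_\ell$ and $T_\ell=T_{\ell+1}-(T_{\ell+1})^0_\ell-(P_\ell-\Lambda(P_\ell))C_\ell(T_{\ell+1})^0_\ell$;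 all other blocks are zero. 4. Let $Z$ be the set of all $z\in\mathbb C^s$ for which there is $x\ne0$ with $M_jx=z_jx$ for $j=1,\dots,s$. 5. Find $(y_z)_{z\in Z}$ with $\sum_{z\in Z} y_z z^\alpha = a(\alpha)$ for $|\alpha|\le m$. Output all pairs $(\log z,\,y_z)$, $z\in Z$, where $\log$ is the componentwise logarithm with values in $(\mathbb C/2\pi i\mathbb Z)^s$. **Theorem.** The maximum $\deg N$ exists and $\deg N<\#\Omega$. Let $n>\deg N$ and let $a(\alpha)=f(\alpha)$ for all $\alpha\in\mathbb N_0^s$ with $|\alpha|\le 2n$. Then the algorithm can be carried out, and, whatever bases and QR factorizations are chosen in it, the following holds: * $m=\deg N$, and the columns of $P_0,\dots,P_{m+1}$ form an H-basis of $I_\Omega$; * the columns of $N_0,\dots,N_m$ form a basis of $N$, and $M_j$ is the matrix of $r\mapsto\nu(z_j r)$ on $N$ in this basis, $j=1,\dots,s$; * the eigenvalues of $M_j$ are exactly the numbers $e^{\omega_j}$, $\omega\in\Omega$, and $Z=\{z_\omega:\omega\in\Omega\}$; * for every $\ell$ with $m\le\ell\le n$, the vector $(y_z)_{z\in Z}$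 is the unique solution of the Vandermonde system $\sum_{z\in Z}y_zz^\alpha=a(\alpha)$, $|\alpha|\le\ell$; * the output is $\{(\omega \bmod 2\pi i\mathbb Z^s,\ f_\omega):\omega\in\Omega\}$. In particular $\Omega$ and all coefficients $f_\omega$ are reconstructed from the values $f(\alpha)$, $|\alpha|\le 2n$. -/

import Mathlib

open scoped Matrix

noncomputable section

namespace Prony

open MvPolynomial

/-! ### Exponential sums -/

/-- The point `e^ω = (e^{ω_1}, …, e^{ω_s})`. -/
def expPt {s : ℕ} (ω : Fin s → ℂ) : Fin s → ℂ := fun j => Complex.exp (ω j)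

/-- The frequency domain `(ℝ + i𝕋)^s = (ℂ / 2πiℤ)^s`. -/
abbrev Freq (s : ℕ) : Type := Fin s → AddCircle (2 * (Real.pi : ℂ) * Complex.I)

/-- The class of `ω` modulo `2πiℤ^s`. -/
def toFreq {s : ℕ} (ω : Fin s → ℂ) : Freq s := fun j => (ω j : AddCircle _)

/-- The componentwise logarithm `(ℂ \ {0})^s → (ℂ / 2πiℤ)^s`. -/
def logFreq {s : ℕ} (z : Fin s → ℂ) : Freq s := toFreq fun j => Complex.log (z j)

/-- The exponential sum `f(x) = ∑_{ω ∈ Ω} f_ω e^{ω^T x}`. -/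
def expSum {s : ℕ} (Ω : Finset (Fin s → ℂ)) (c : (Fin s → ℂ) → ℂ) (x : Fin s → ℂ) : ℂ :=
  ∑ ω ∈ Ω, c ω * Complex.exp (∑ j, ω j * x j)

/-! ### Polynomials, ideals and normal forms -/

/-- The ideal `I_Ω` of all polynomials that vanish at all points `e^ω`, `ω ∈ Ω`. -/
def idealOf {s : ℕ} (Ω : Finset (Fin s → ℂ)) : Ideal (MvPolynomial (Fin s) ℂ) :=
  vanishingIdeal ℂ (expPt '' (Ω : Set (Fin s → ℂ)))

/-- The leading form `Λ(p)`. -/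
def leadingForm {s : ℕ} (p : MvPolynomial (Fin s) ℂ) : MvPolynomial (Fin s) ℂ :=
  homogeneousComponent p.totalDegree p

/-- The inner product `(p, q) = ∑_α p_α conj(q_α)`. -/
def coeffInner {s : ℕ} (p q : MvPolynomial (Fin s) ℂ) : ℂ :=
  ∑ α ∈ p.support, p.coeff α * star (q.coeff α)

/-- A finite family `h` is an H-basis of the ideal `I`. The zero polynomial counts as a
coefficient of degree `-∞`. -/
def IsHBasis {s : ℕ} {ι : Type*} [Fintype ι] (I : Ideal (MvPolynomial (Fin s) ℂ))
    (h : ι → MvPolynomial (Fin s) ℂ) : Prop :=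
  ∀ p : MvPolynomial (Fin s) ℂ, p ∈ I ↔
    ∃ q : ι → MvPolynomial (Fin s) ℂ, p = ∑ i, q i * h i ∧
      ∀ i, q i ≠ 0 → (q i).totalDegree + (h i).totalDegree ≤ p.totalDegree

/-- Every homogeneous component of `r` is orthogonal to all leading forms of the ideal. -/
def IsReduced {s : ℕ} (I : Ideal (MvPolynomial (Fin s) ℂ)) (r : MvPolynomial (Fin s) ℂ) : Prop :=
  ∀ k : ℕ, ∀ q ∈ I, q.totalDegree ≤ k →
    coeffInner (homogeneousComponent k r) (leadingForm q) = 0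

/-- `r` is the normal form (remainder) `ν(p)` of `p` modulo `I`. -/
def IsNormalForm {s : ℕ} (I : Ideal (MvPolynomial (Fin s) ℂ))
    (p r : MvPolynomial (Fin s) ℂ) : Prop :=
  p - r ∈ I ∧ r.totalDegree ≤ p.totalDegree ∧ IsReduced I r

theorem coeffInner_eq_finsum {s : ℕ} (p q : MvPolynomial (Fin s) ℂ) :
    coeffInner p q = ∑ᶠ α, p.coeff α * star (q.coeff α) := by
  refine (finsum_eq_sum_of_support_subset _ ?_).symm
  intro α hα
  simp only [Function.mem_support, ne_eq, mul_eq_zero, not_or] at hα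
  simpa using hα.1

theorem coeffInner_add {s : ℕ} (p p' q : MvPolynomial (Fin s) ℂ) :
    coeffInner (p + p') q = coeffInner p q + coeffInner p' q := by
  have hfin : ∀ p : MvPolynomial (Fin s) ℂ,
      (Function.support fun α => p.coeff α * star (q.coeff α)).Finite := fun p =>
    p.support.finite_toSet.subset fun α hα => by
      simp only [Function.mem_support, ne_eq, mul_eq_zero, not_or] at hα
      simpa using hα.1
  simp only [coeffInner_eq_finsum, coeff_add, add_mul]
  exact finsum_add_distrib (hfin p) (hfin p')

theorem coeffInner_smul {s : ℕ} (c : ℂ) (p q : MvPolynomial (Fin s) ℂ) :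
    coeffInner (c • p) q = c * coeffInner p q := by
  simp only [coeffInner_eq_finsum, coeff_smul, smul_eq_mul, mul_assoc]
  rw [mul_finsum]

theorem exists_isNormalForm_iff {s : ℕ} (I : Ideal (MvPolynomial (Fin s) ℂ))
    (r : MvPolynomial (Fin s) ℂ) : (∃ p, IsNormalForm I p r) ↔ IsReduced I r :=
  ⟨fun ⟨_, h⟩ => h.2.2, fun h => ⟨r, by simp, le_rfl, h⟩⟩

/-- The normal form space `N = ν(Π)` modulo `I`. -/
def normalFormSpace {s : ℕ} (I : Ideal (MvPolynomial (Fin s) ℂ)) :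
    Submodule ℂ (MvPolynomial (Fin s) ℂ) where
  carrier := {r | ∃ p, IsNormalForm I p r}
  zero_mem' := (exists_isNormalForm_iff I 0).2 fun k q _ _ => by simp [coeffInner]
  add_mem' {r r'} hr hr' := by
    have h := (exists_isNormalForm_iff I r).1 hr
    have h' := (exists_isNormalForm_iff I r').1 hr'
    refine (exists_isNormalForm_iff I _).2 fun k q hq hk => ?_
    rw [map_add, coeffInner_add, h k q hq hk, h' k q hq hk, add_zero]
  smul_mem' c r hr := by
    have h := (exists_isNormalForm_iff I r).1 hr
    refine (exists_isNormalForm_iff I _).2 fun k q hq hk => ?_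
    rw [map_smul, coeffInner_smul, h k q hq hk, mul_zero]

/-- `deg N`, the maximal degree of the elements of the normal form space modulo `I_Ω`. -/
def degN {s : ℕ} (Ω : Finset (Fin s → ℂ)) : ℕ :=
  sSup {d | ∃ r ∈ normalFormSpace (idealOf Ω), r.totalDegree = d}

/-! ### Coefficient vectors and matrices -/

/-- Multiindices with `|α| ≤ k`. -/
abbrev MIdx (s k : ℕ) : Type := {α : Fin s →₀ ℕ // α.degree ≤ k}

/-- Multiindices with `|α| = k`. -/
abbrev HIdx (s k : ℕ) : Type := {α : Fin s →₀ ℕ // α.degree = k}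

instance (s k : ℕ) : Fintype (MIdx s k) := (Finsupp.finite_of_degree_le k).fintype

instance (s k : ℕ) : Fintype (HIdx s k) :=
  ((Finsupp.finite_of_degree_le k).subset fun _ h => le_of_eq h).fintype

/-- The polynomial of degree at most `k` with coefficient vector `v`. -/
def toPoly {s k : ℕ} (v : MIdx s k → ℂ) : MvPolynomial (Fin s) ℂ :=
  ∑ α, monomial α.1 (v α)

/-- The homogeneous polynomial of degree `k` with coefficient vector `v`. -/
def toForm {s k : ℕ} (v : HIdx s k → ℂ) : MvPolynomial (Fin s) ℂ :=
  ∑ α, monomial α.1 (v α)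

/-- The matrix `F_{n,k} = [a(α + β)]`, `|α| ≤ n`, `|β| ≤ k`. -/
def hankel {s : ℕ} (a : (Fin s →₀ ℕ) → ℂ) (n k : ℕ) : Matrix (MIdx s n) (MIdx s k) ℂ :=
  Matrix.of fun α β => a (α.1 + β.1)

/-- Coefficient vectors of polynomials of degree at most `k` (the columns), padded by zeros to
coefficient vectors of polynomials of degree at most `l`, for `k ≤ l`. -/
def pad {s k : ℕ} {ι : Type*} (l : ℕ) (A : Matrix (MIdx s k) ι ℂ) : Matrix (MIdx s l) ι ℂ :=
  Matrix.of fun α i => if h : α.1.degree ≤ k then A ⟨α.1, h⟩ i else 0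

/-- Coefficient vectors of forms of degree `k` (the columns), padded by zeros to
coefficient vectors of polynomials of degree at most `l`, for `k ≤ l`. -/
def padForm {s k : ℕ} {ι : Type*} (l : ℕ) (A : Matrix (HIdx s k) ι ℂ) : Matrix (MIdx s l) ι ℂ :=
  Matrix.of fun α i => if h : α.1.degree = k then A ⟨α.1, h⟩ i else 0

/-- The homogeneous parts of degree `l` of the columns, which are coefficient vectors of
polynomials of degree at most `k`, for `l ≤ k`. -/
def formPart {s k : ℕ} {ι : Type*} (l : ℕ) (A : Matrix (MIdx s k) ι ℂ) : Matrix (HIdx s l) ι ℂ :=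
  Matrix.of fun α i => if h : α.1.degree ≤ k then A ⟨α.1, h⟩ i else 0

/-- For `l = k + 1`, the matrix `L_{k,j}` of the multiplication of forms of degree `k` by the
variable `z_j`. -/
def shift {s : ℕ} (j : Fin s) (l k : ℕ) : Matrix (HIdx s l) (HIdx s k) ℂ :=
  Matrix.of fun α β => if α.1 = β.1 + Finsupp.single j 1 then 1 else 0

/-- The Vandermonde matrix `[z^α]`, `z ∈ Z`, `|α| ≤ k`. -/
def vandermonde {s : ℕ} (Z : Finset (Fin s → ℂ)) (k : ℕ) : Matrix Z (MIdx s k) ℂ :=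
  Matrix.of fun z α => ∏ j, z.1 j ^ α.1 j

/-! ### Linear algebra -/

/-- The columns of `B` form a basis of the kernel of `A`. -/
def IsKernelBasis {m n ι : Type*} [Fintype n] (A : Matrix m n ℂ) (B : Matrix n ι ℂ) : Prop :=
  LinearIndependent ℂ B.col ∧ Submodule.span ℂ (Set.range B.col) = LinearMap.ker A.mulVecLin

/-- `B` is the Moore–Penrose inverse of `A`. -/
structure IsMoorePenrose {m n : Type*} [Fintype m] [Fintype n] (A : Matrix m n ℂ)
    (B : Matrix n m ℂ) : Prop where
  left : A * B * A = A
  right : B * A * B = B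
  herm_left : (A * B)ᴴ = A * B
  herm_right : (B * A)ᴴ = B * A

/-- A full `QR` factorization `A = [Q₁, Q₂] [R; 0]`, with `[Q₁, Q₂]` unitary and `R` upper
triangular. -/
structure IsQR {m p q : Type*} [Fintype m] [DecidableEq m] [Fintype p] [DecidableEq p]
    [LinearOrder p] [Fintype q] [DecidableEq q]
    (A : Matrix m p ℂ) (Q₁ : Matrix m p ℂ) (Q₂ : Matrix m q ℂ) (R : Matrix p p ℂ) : Prop where
  factor : A = Matrix.fromCols Q₁ Q₂ * Matrix.fromRows R 0
  isometry : (Matrix.fromCols Q₁ Q₂)ᴴ * Matrix.fromCols Q₁ Q₂ = 1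
  unitary : Matrix.fromCols Q₁ Q₂ * (Matrix.fromCols Q₁ Q₂)ᴴ = 1
  upper : ∀ i j, j < i → R i j = 0

/-! ### Graded bases -/

/-- The number `v_k = w_0 + ⋯ + w_k` of columns of `[P_0, …, P_k]`. -/
def vol (w : ℕ → ℕ) : ℕ → ℕ
  | 0 => w 0
  | k + 1 => vol w k + w (k + 1)

/-- The block upper triangular matrix `K_k = [P_0, …, P_k]`. -/
def gradedK {s : ℕ} {w : ℕ → ℕ} (P : ∀ k, Matrix (MIdx s k) (Fin (w k)) ℂ) :
    ∀ k, Matrix (MIdx s k) (Fin (vol w k)) ℂ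
  | 0 => P 0
  | k + 1 => (Matrix.fromCols (pad (k + 1) (gradedK P k)) (P (k + 1))).submatrix id
      finSumFinEquiv.symm

/-- A run of the second step of the algorithm on the samples `a`: the loop over `k` with all the
matrices it computes. The bases of the kernels and the `QR` factorizations are not unique, so that
there are many runs. Nothing is asked of the values of the families at indices that the
loop does not reach. -/
structure GradedBases (s n : ℕ) (a : (Fin s →₀ ℕ) → ℂ) where
  /-- The last value of `k` in the loop. -/
  m : ℕ
  m_lt : m < n
  rank_eq : (hankel a n m).rank = (hankel a n (m + 1)).rank
  rank_ne : ∀ k < m, (hankel a n k).rank ≠ (hankel a n (k + 1)).rank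
  /-- `w k` is the number of columns of `P k`. -/
  w : ℕ → ℕ
  w_zero : w 0 = 0
  /-- The graded ideal basis. -/
  P : ∀ k, Matrix (MIdx s k) (Fin (w k)) ℂ
  /-- The bases of the kernels from which `P` is derived. -/
  Pt : ∀ k, Matrix (MIdx s k) (Fin (vol w k)) ℂ
  Pt_basis : ∀ k ≤ m, IsKernelBasis (hankel a n (k + 1)) (Pt (k + 1))
  /-- The pseudoinverse of `Pt k`. -/
  Pinv : ∀ k, Matrix (Fin (vol w k)) (MIdx s k) ℂ
  Pinv_spec : ∀ k ≤ m, IsMoorePenrose (Pt (k + 1)) (Pinv (k + 1))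
  /-- The `QR` factorization of `X = Pinv (k + 1) * [K_k; 0]`. -/
  XQ₁ : ∀ k, Matrix (Fin (vol w (k + 1))) (Fin (vol w k)) ℂ
  XQ₂ : ∀ k, Matrix (Fin (vol w (k + 1))) (Fin (w (k + 1))) ℂ
  XR : ∀ k, Matrix (Fin (vol w k)) (Fin (vol w k)) ℂ
  X_qr : ∀ k ≤ m, IsQR (Pinv (k + 1) * pad (k + 1) (gradedK P k)) (XQ₁ k) (XQ₂ k) (XR k)
  P_succ : ∀ k ≤ m, P (k + 1) = Pt (k + 1) * XQ₂ k
  /-- `d k` is the number of columns of `N k`. -/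
  d : ℕ → ℕ
  /-- The `QR` factorization of the matrix `Λ(P k)` of the leading forms, with
  `N k` the orthogonal complement. -/
  Q : ∀ k, Matrix (HIdx s k) (Fin (w k)) ℂ
  N : ∀ k, Matrix (HIdx s k) (Fin (d k)) ℂ
  R : ∀ k, Matrix (Fin (w k)) (Fin (w k)) ℂ
  N_qr : ∀ k ≤ m + 1, IsQR (formPart k (P k)) (Q k) (N k) (R k)

namespace GradedBases

variable {s n : ℕ} {a : (Fin s →₀ ℕ) → ℂ} (G : GradedBases s n a)

/-- The polynomials in `P_0, …, P_{m+1}`. -/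
def idealBasis (i : Σ k : Fin (G.m + 2), Fin (G.w k)) : MvPolynomial (Fin s) ℂ :=
  toPoly ((G.P i.1).col i.2)

/-- The index set of the normal form basis `[N_0, …, N_m]`. -/
abbrev NIdx : Type := Σ k : Fin (G.m + 1), Fin (G.d k)

/-- The homogeneous polynomials in `N_0, …, N_m`. -/
def normalBasis (i : G.NIdx) : MvPolynomial (Fin s) ℂ :=
  toForm ((G.N i.1).col i.2)

/-! ### Multiplication tables -/

/-- `R_l⁻¹ Q_{l,1}ᴴ`. -/
def C (l : ℕ) : Matrix (Fin (G.w l)) (HIdx s l) ℂ := (G.R l)⁻¹ * (G.Q l)ᴴ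

/-- The matrix `Λ(P_l)` of leading forms. -/
def L (l : ℕ) : Matrix (HIdx s l) (Fin (G.w l)) ℂ := formPart l (G.P l)

/-- The matrix `T_{k+1-t}` in the reduction of the columns of `L_{k,j} N_k`. -/
def T (j : Fin s) (k : ℕ) : ℕ → Matrix (MIdx s (k + 1)) (Fin (G.d k)) ℂ
  | 0 => (padForm (k + 1) (G.L (k + 1)) - G.P (k + 1)) * G.C (k + 1) * (shift j (k + 1) k * G.N k)
  | t + 1 =>
      T j k t - padForm (k + 1) (formPart (k - t) (T j k t)) -
        (pad (k + 1) (G.P (k - t)) - padForm (k + 1) (G.L (k - t))) * G.C (k - t) *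
          formPart (k - t) (T j k t)

/-- The block `(M_j)_{l,k}` for `l = k + 1`. -/
def lowerBlock (j : Fin s) (l k : ℕ) : Matrix (Fin (G.d l)) (Fin (G.d k)) ℂ :=
  (G.N l)ᴴ * ((1 - G.L l * G.C l) * (shift j l k * G.N k))

/-- The block `(M_j)_{l,k}` for `l ≤ k`; here `T_{l+1}` is `T j k (k - l)`. -/
def upperBlock (j : Fin s) (l k : ℕ) : Matrix (Fin (G.d l)) (Fin (G.d k)) ℂ :=
  (G.N l)ᴴ * ((1 - G.L l * G.C l) * formPart l (G.T j k (k - l)))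

/-- The block `(M_j)_{l,k}`. -/
def block (j : Fin s) (l k : ℕ) : Matrix (Fin (G.d l)) (Fin (G.d k)) ℂ :=
  if l ≤ k then G.upperBlock j l k else if l = k + 1 then G.lowerBlock j l k else 0

/-- The multiplication table `M_j`. -/
def table (j : Fin s) : Matrix G.NIdx G.NIdx ℂ :=
  Matrix.of fun i i' => G.block j i.1 i'.1 i.2 i'.2

end GradedBases

/-! ### The algorithm -/

/-- A run of Prony's method in several variables with parameter `n` on the samples `a`. -/
structure Run (s n : ℕ) (a : (Fin s →₀ ℕ) → ℂ) where
  /-- The graded ideal basis and the graded normal form basis. -/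
  bases : GradedBases s n a
  /-- The points: the matched eigenvalues, that is, the tuples of eigenvalues of
  `M_1, …, M_s` that belong to a common eigenvector. -/
  points : Finset (Fin s → ℂ)
  mem_points : ∀ z, z ∈ points ↔
    ∃ x : bases.NIdx → ℂ, x ≠ 0 ∧ ∀ j, bases.table j *ᵥ x = z j • x
  /-- The coefficients. -/
  coef : points → ℂ
  coef_solves : (vandermonde points bases.m)ᵀ *ᵥ coef = fun α => a α.1

/-- The output of a run: the set of all pairs of a frequency and its coefficient. -/
def Run.output {s n : ℕ} {a : (Fin s →₀ ℕ) → ℂ} (A : Run s n a) : Set (Freq s × ℂ) :=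
  Set.range fun z : A.points => (logFreq z.1, A.coef z)

end Prony

end

noncomputable section

namespace Prony

open MvPolynomial

/-! ### Polynomials and coefficient vectors -/

/-! Everything rests on the factorization of the Hankel matrix, F_{n,k} = V_nᵀ diag(f_ω) V_k, where
V_k is the Vandermonde matrix of the points z_ω (`hankel_mulVec`). Polynomials of degree at most deg
N interpolate arbitrary data at the points, so for n ≥ deg N the factor V_nᵀ diag(f_ω) is injective
(`weights_eq_zero`). Hence ker F_{n,k} consists of the coefficient vectors of I ∩ Π_k, where I =
I_Ω, and rank F_{n,k} is the dimension of Π_k restricted to the points (`ker_hankel`,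
`rank_hankel`).

The ranks at k and k+1 agree exactly if Π_{k+1} ⊆ Π_k + I, the property `Stable`. It passes from k
to k+1, since a monomial of degree k+2 is a variable times one of degree k+1. The least stable k is
deg N, and it is below #Ω because the dimension starts at 1 and grows strictly until then
(`exists_isLeast_stable`).

The two factorizations in the loop make P_{k+1} a complement of I ∩ Π_k in I ∩ Π_{k+1}
(`isColBasis_fromCols`). No nontrivial combination of its columns drops in degree, so their leading
parts form a basis of the degree-(k+1) parts of I ∩ Π_{k+1} (`isColBasis_formPart`). This gives the
H-basis by descent on the degree. It also makes Q_{k,1} and N_k orthonormal bases of the leading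
forms of degree k and of their orthogonal complement, the normal forms of degree k.

Therefore I - Λ(P_l) C_l = N_l N_l^* is an orthogonal projection, and the recursion for T_l is a
degree-by-degree division: each step splits off the normal form part of the current top degree and
subtracts an element of the ideal (`sub_sum_blocks_mem`). So M_j represents multiplication by z_j on
Π/I ≅ N. Its joint eigenvectors come from the Lagrange polynomials of the points, with the
coordinates of the points as eigenvalues. The injectivity already used for the kernel makes the
Vandermonde system for the coefficients uniquely solvable. -/

theorem totalDegree_le_iff_coeff {s k : ℕ} {p : MvPolynomial (Fin s) ℂ} :
    p.totalDegree ≤ k ↔ ∀ α : Fin s →₀ ℕ, k < α.degree → coeff α p = 0 := by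
  rw [MvPolynomial.totalDegree, Finset.sup_le_iff]
  refine forall_congr' fun α => ?_
  have : (α.sum fun _ e => e) = α.degree := rfl
  rw [this, mem_support_iff, not_imp_comm, not_le]

theorem coeff_toPoly {s k : ℕ} (v : MIdx s k → ℂ) (α : Fin s →₀ ℕ) :
    coeff α (toPoly v) = if h : α.degree ≤ k then v ⟨α, h⟩ else 0 := by
  classical
  rw [toPoly, coeff_sum]
  simp only [coeff_monomial]
  split_ifs with h
  · rw [Finset.sum_eq_single ⟨α, h⟩]
    · simp
    · intro b _ hb
      rw [if_neg]
      exact fun h' => hb (Subtype.ext h')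
    · simp
  · refine Finset.sum_eq_zero fun b _ => if_neg fun h' => h ?_
    rw [← h']; exact b.2

theorem coeff_toForm {s k : ℕ} (v : HIdx s k → ℂ) (α : Fin s →₀ ℕ) :
    coeff α (toForm v) = if h : α.degree = k then v ⟨α, h⟩ else 0 := by
  classical
  rw [toForm, coeff_sum]
  simp only [coeff_monomial]
  split_ifs with h
  · rw [Finset.sum_eq_single ⟨α, h⟩]
    · simp
    · intro b _ hb
      rw [if_neg]
      exact fun h' => hb (Subtype.ext h')
    · simp
  · refine Finset.sum_eq_zero fun b _ => if_neg fun h' => h ?_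
    rw [← h']; exact b.2

/-- `toPoly` as a linear map. -/
def toPolyₗ (s k : ℕ) : (MIdx s k → ℂ) →ₗ[ℂ] MvPolynomial (Fin s) ℂ where
  toFun := toPoly
  map_add' u v := by simp [toPoly, Finset.sum_add_distrib]
  map_smul' r v := by simp [toPoly, Finset.smul_sum, smul_monomial]

/-- `toForm` as a linear map. -/
def toFormₗ (s k : ℕ) : (HIdx s k → ℂ) →ₗ[ℂ] MvPolynomial (Fin s) ℂ where
  toFun := toForm
  map_add' u v := by simp [toForm, Finset.sum_add_distrib]
  map_smul' r v := by simp [toForm, Finset.smul_sum, smul_monomial]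

theorem toPolyₗ_apply {s k : ℕ} (v : MIdx s k → ℂ) : toPolyₗ s k v = toPoly v := rfl

theorem toFormₗ_apply {s k : ℕ} (v : HIdx s k → ℂ) : toFormₗ s k v = toForm v := rfl

/-- The coefficients of degree at most `k`. -/
def coeffVec {s : ℕ} (k : ℕ) (p : MvPolynomial (Fin s) ℂ) : MIdx s k → ℂ := fun α => coeff α.1 p

/-- The coefficients of degree `k`. -/
def formVec {s : ℕ} (k : ℕ) (p : MvPolynomial (Fin s) ℂ) : HIdx s k → ℂ := fun α => coeff α.1 p

theorem totalDegree_toPoly_le {s k : ℕ} (v : MIdx s k → ℂ) : (toPoly v).totalDegree ≤ k :=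
  totalDegree_le_iff_coeff.2 fun α h => by rw [coeff_toPoly, dif_neg (not_le.2 h)]

theorem toPoly_coeffVec {s k : ℕ} {p : MvPolynomial (Fin s) ℂ} (h : p.totalDegree ≤ k) :
    toPoly (coeffVec k p) = p := by
  ext α
  rw [coeff_toPoly]
  split_ifs with h'
  · rfl
  · exact (totalDegree_le_iff_coeff.1 h α (not_le.1 h')).symm

theorem coeffVec_toPoly {s k : ℕ} (v : MIdx s k → ℂ) : coeffVec k (toPoly v) = v := by
  ext α
  rw [coeffVec, coeff_toPoly, dif_pos α.2]

theorem toForm_formVec {s k : ℕ} (p : MvPolynomial (Fin s) ℂ) :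
    toForm (formVec k p) = homogeneousComponent k p := by
  ext α
  rw [coeff_toForm, coeff_homogeneousComponent]
  rfl

theorem formVec_toForm {s k : ℕ} (v : HIdx s k → ℂ) : formVec k (toForm v) = v := by
  ext α
  rw [formVec, coeff_toForm, dif_pos α.2]

theorem toPoly_injective (s k : ℕ) :
    Function.Injective (toPoly : (MIdx s k → ℂ) → MvPolynomial (Fin s) ℂ) :=
  Function.LeftInverse.injective coeffVec_toPoly

theorem toForm_injective (s k : ℕ) :
    Function.Injective (toForm : (HIdx s k → ℂ) → MvPolynomial (Fin s) ℂ) :=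
  Function.LeftInverse.injective formVec_toForm

theorem toForm_zero (s k : ℕ) : toForm (0 : HIdx s k → ℂ) = 0 := map_zero (toFormₗ s k)

theorem toPoly_zero (s k : ℕ) : toPoly (0 : MIdx s k → ℂ) = 0 := map_zero (toPolyₗ s k)

theorem isHomogeneous_toForm {s k : ℕ} (v : HIdx s k → ℂ) : (toForm v).IsHomogeneous k := by
  rw [← formVec_toForm v, toForm_formVec]
  exact homogeneousComponent_isHomogeneous k _

theorem homogeneousComponent_toForm {s k : ℕ} (v : HIdx s k → ℂ) (l : ℕ) :
    homogeneousComponent l (toForm v) = if l = k then toForm v else 0 :=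
  homogeneousComponent_of_mem (isHomogeneous_toForm v)

theorem totalDegree_toForm_le {s k : ℕ} (v : HIdx s k → ℂ) : (toForm v).totalDegree ≤ k :=
  (isHomogeneous_toForm v).totalDegree_le

theorem homogeneousComponent_toPoly {s k : ℕ} {ι : Type*} [Fintype ι]
    (A : Matrix (MIdx s k) ι ℂ) (x : ι → ℂ) (l : ℕ) :
    homogeneousComponent l (toPoly (A *ᵥ x)) = toForm (formPart l A *ᵥ x) := by
  ext α
  rw [coeff_homogeneousComponent, coeff_toPoly, coeff_toForm]
  split_ifs with h1 h2
  · simp only [Matrix.mulVec, dotProduct, formPart, Matrix.of_apply, dif_pos h2]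
  · simp only [Matrix.mulVec, dotProduct, formPart, Matrix.of_apply, dif_neg h2, zero_mul,
      Finset.sum_const_zero]
  · rfl

theorem toPoly_pad {s k l : ℕ} (hkl : k ≤ l) {ι : Type*} [Fintype ι]
    (A : Matrix (MIdx s k) ι ℂ) (x : ι → ℂ) :
    toPoly (pad l A *ᵥ x) = toPoly (A *ᵥ x) := by
  ext α
  rw [coeff_toPoly, coeff_toPoly]
  split_ifs with h1 h2 h2
  · simp [Matrix.mulVec, dotProduct, pad, *]
  · simp [Matrix.mulVec, dotProduct, pad, *]
  · omega
  · rfl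

theorem toPoly_padForm {s k l : ℕ} (hkl : k ≤ l) {ι : Type*} [Fintype ι]
    (A : Matrix (HIdx s k) ι ℂ) (x : ι → ℂ) :
    toPoly (padForm l A *ᵥ x) = toForm (A *ᵥ x) := by
  ext α
  rw [coeff_toPoly, coeff_toForm]
  split_ifs with h1 h2 h2
  · simp [Matrix.mulVec, dotProduct, padForm, *]
  · simp [Matrix.mulVec, dotProduct, padForm, *]
  · omega
  · rfl

theorem toForm_shift {s k : ℕ} (j : Fin s) (v : HIdx s k → ℂ) :
    toForm (shift j (k + 1) k *ᵥ v) = X j * toForm v := by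
  classical
  ext α
  rw [coeff_toForm, mul_comm, coeff_mul_X', coeff_toForm]
  have hdeg : ∀ β : Fin s →₀ ℕ, (β + Finsupp.single j 1).degree = β.degree + 1 := fun β => by
    rw [map_add, Finsupp.degree_single]
  by_cases hj : j ∈ α.support
  · have hα : α - Finsupp.single j 1 + Finsupp.single j 1 = α := by
      refine tsub_add_cancel_of_le (Finsupp.single_le_iff.2 ?_)
      exact Nat.one_le_iff_ne_zero.2 (Finsupp.mem_support_iff.1 hj)
    have hd := hdeg (α - Finsupp.single j 1)
    rw [hα] at hd
    rw [if_pos hj]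
    split_ifs with h1 h2 h2
    · simp only [Matrix.mulVec, dotProduct, shift, Matrix.of_apply]
      rw [Finset.sum_eq_single ⟨α - Finsupp.single j 1, h2⟩]
      · rw [if_pos hα.symm, one_mul]
      · intro β _ hβ
        rw [if_neg, zero_mul]
        intro h
        apply hβ
        apply Subtype.ext
        simp [h]
      · simp
    · omega
    · omega
    · rfl
  · rw [if_neg hj]
    split_ifs with h1
    · simp only [Matrix.mulVec, dotProduct, shift, Matrix.of_apply]
      refine Finset.sum_eq_zero fun β _ => ?_
      rw [if_neg, zero_mul]
      intro h
      apply hj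
      simp [h]
    · rfl

/-! ### The coefficient inner product, leading forms and reduced polynomials. -/

theorem coeffInner_toForm {s k : ℕ} (u v : HIdx s k → ℂ) :
    coeffInner (toForm u) (toForm v) = star v ⬝ᵥ u := by
  rw [coeffInner_eq_finsum]
  rw [finsum_eq_sum_of_support_subset (s := Finset.univ.map (Function.Embedding.subtype
    fun α : Fin s →₀ ℕ => α.degree = k))]
  · rw [Finset.sum_map]
    simp only [dotProduct, Function.Embedding.subtype_apply, Pi.star_apply]
    refine Finset.sum_congr rfl fun α _ => ?_
    rw [coeff_toForm, coeff_toForm, dif_pos α.2, dif_pos α.2, mul_comm]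
  · intro α hα
    by_contra h
    apply hα
    have : ¬ α.degree = k := fun hk => h (by simpa using hk)
    simp only [coeff_toForm, dif_neg this, zero_mul]

theorem coeffInner_self_eq_zero {s : ℕ} {p : MvPolynomial (Fin s) ℂ} (h : coeffInner p p = 0) :
    p = 0 := by
  have h' : ∑ α ∈ p.support, ‖coeff α p‖ ^ 2 = 0 := by
    have : ((∑ α ∈ p.support, ‖coeff α p‖ ^ 2 : ℝ) : ℂ) = 0 := by
      rw [← h, coeffInner]
      push_cast
      refine Finset.sum_congr rfl fun α _ => ?_
      exact (RCLike.mul_conj (coeff α p)).symm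
    exact_mod_cast this
  rw [Finset.sum_eq_zero_iff_of_nonneg fun _ _ => by positivity] at h'
  ext α
  by_contra hα
  have := h' α (mem_support_iff.2 hα)
  simp only [coeff_zero] at hα
  simp [hα] at this

theorem totalDegree_le_of_homogeneousComponent_eq_zero {s k : ℕ} {p : MvPolynomial (Fin s) ℂ}
    (h : p.totalDegree ≤ k + 1) (h0 : homogeneousComponent (k + 1) p = 0) : p.totalDegree ≤ k := by
  rw [totalDegree_le_iff_coeff] at h ⊢
  intro α hα
  rcases Nat.lt_or_ge (k + 1) α.degree with h1 | h1
  · exact h α h1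
  · have h2 := congrArg (coeff α) h0
    rw [coeff_homogeneousComponent, if_pos (by omega)] at h2
    simpa using h2

theorem leadingForm_ne_zero {s : ℕ} {p : MvPolynomial (Fin s) ℂ} (h : p ≠ 0) :
    leadingForm p ≠ 0 := by
  obtain ⟨α, hα, hd⟩ := p.support.exists_mem_eq_sup (support_nonempty.2 h)
    (fun α => α.sum fun _ e => e)
  intro h0
  have h2 := congrArg (coeff α) h0
  have hd' : α.degree = p.totalDegree := hd.symm
  rw [leadingForm, coeff_homogeneousComponent, if_pos hd'] at h2
  exact (mem_support_iff.1 hα) (by simpa using h2)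

/-- Reducedness with the components of degree `k` in place of the leading forms. -/
theorem isReduced_iff {s : ℕ} {I : Ideal (MvPolynomial (Fin s) ℂ)}
    {r : MvPolynomial (Fin s) ℂ} : IsReduced I r ↔ ∀ k : ℕ, ∀ q ∈ I, q.totalDegree ≤ k →
      coeffInner (homogeneousComponent k r) (homogeneousComponent k q) = 0 := by
  refine forall_congr' fun k => forall_congr' fun q => forall_congr' fun _ =>
    forall_congr' fun hk => ?_
  rcases hk.eq_or_lt with rfl | hk
  · rfl
  · have h1 : coeffInner (homogeneousComponent k r) (homogeneousComponent k q) = 0 := by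
      rw [homogeneousComponent_eq_zero _ _ hk]
      simp [coeffInner]
    have h2 : coeffInner (homogeneousComponent k r) (leadingForm q) = 0 := by
      rw [coeffInner, leadingForm]
      refine Finset.sum_eq_zero fun α hα => ?_
      rw [mem_support_iff, coeff_homogeneousComponent, ite_ne_right_iff] at hα
      rw [coeff_homogeneousComponent _ q, if_neg (by omega)]
      simp
    simp only [h1, h2]

theorem mem_normalFormSpace {s : ℕ} {I : Ideal (MvPolynomial (Fin s) ℂ)}
    {r : MvPolynomial (Fin s) ℂ} : r ∈ normalFormSpace I ↔ IsReduced I r :=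
  exists_isNormalForm_iff I r

theorem eq_zero_of_mem_of_isReduced {s : ℕ} {I : Ideal (MvPolynomial (Fin s) ℂ)}
    {r : MvPolynomial (Fin s) ℂ} (hr : IsReduced I r) (h : r ∈ I) : r = 0 := by
  by_contra h0
  exact leadingForm_ne_zero h0 (coeffInner_self_eq_zero (hr _ r h le_rfl))

theorem eq_sum_homogeneousComponent {s k : ℕ} {p : MvPolynomial (Fin s) ℂ}
    (h : p.totalDegree ≤ k) : ∑ i : Fin (k + 1), homogeneousComponent (i : ℕ) p = p := by
  rw [Fin.sum_univ_eq_sum_range fun i => homogeneousComponent i p]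
  conv_rhs => rw [← sum_homogeneousComponent p]
  refine (Finset.sum_subset (Finset.range_subset_range.2 (by omega)) fun i _ hi => ?_).symm
  exact homogeneousComponent_eq_zero _ _ (by simpa using hi)

/-! ### Degrees modulo the ideal -/

/-- Every polynomial of degree `k + 1` has degree at most `k` modulo `I`. -/
def Stable {s : ℕ} (I : Ideal (MvPolynomial (Fin s) ℂ)) (k : ℕ) : Prop :=
  restrictTotalDegree (Fin s) ℂ (k + 1) ≤ restrictTotalDegree (Fin s) ℂ k ⊔ I.restrictScalars ℂ

theorem restrictTotalDegree_mono {s k l : ℕ} (h : k ≤ l) :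
    restrictTotalDegree (Fin s) ℂ k ≤ restrictTotalDegree (Fin s) ℂ l := fun p hp => by
  rw [mem_restrictTotalDegree] at hp ⊢
  exact hp.trans h

/-- The target `V'` may differ from `V`: with `V = V' = I` this propagates stability, and with the
filtered spaces `combos` it later controls the degrees of the coefficients in the H-basis. -/
theorem restrictTotalDegree_succ_le {s k : ℕ} {V V' : Submodule ℂ (MvPolynomial (Fin s) ℂ)}
    (hV : ∀ j, ∀ v ∈ V, X j * v ∈ V')
    (h : restrictTotalDegree (Fin s) ℂ (k + 1) ≤ restrictTotalDegree (Fin s) ℂ k ⊔ V) :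
    restrictTotalDegree (Fin s) ℂ (k + 2) ≤ restrictTotalDegree (Fin s) ℂ (k + 1) ⊔ V' := by
  intro p hp
  rw [mem_restrictTotalDegree, MvPolynomial.totalDegree, Finset.sup_le_iff] at hp
  rw [p.as_sum]
  refine Submodule.sum_mem _ fun α hα => ?_
  have hd : α.degree ≤ k + 2 := hp α hα
  rcases hd.lt_or_eq with hd | hd
  · refine Submodule.mem_sup_left ((mem_restrictTotalDegree _ _ _).2 ?_)
    exact (totalDegree_monomial_le _ _).trans (Nat.lt_succ_iff.1 hd)
  -- A monomial of top degree `k + 2 > 0` contains some variable; splitting it off leaves a monomial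
  -- of degree `k + 1`, to which `h` applies.
  · obtain ⟨j, hj⟩ : ∃ j, α j ≠ 0 := by
      by_contra! h0
      have : α = 0 := Finsupp.ext h0
      simp [this] at hd
    have hα' : Finsupp.single j 1 + (α - Finsupp.single j 1) = α := by
      rw [add_comm]
      exact tsub_add_cancel_of_le (Finsupp.single_le_iff.2 (Nat.one_le_iff_ne_zero.2 hj))
    have hd' : (α - Finsupp.single j 1).degree = k + 1 := by
      have := congrArg Finsupp.degree hα'
      rw [map_add, Finsupp.degree_single] at this
      omega
    have hm : monomial α (coeff α p) =
        X j * monomial (α - Finsupp.single j 1) (coeff α p) := by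
      rw [X, monomial_mul, one_mul, hα']
    have hmem : monomial (α - Finsupp.single j 1) (coeff α p) ∈
        restrictTotalDegree (Fin s) ℂ (k + 1) :=
      (mem_restrictTotalDegree _ _ _).2 ((totalDegree_monomial_le _ _).trans hd'.le)
    obtain ⟨q, hq, g, hg, hqg⟩ := Submodule.mem_sup.1 (h hmem)
    rw [hm, ← hqg, mul_add]
    refine Submodule.add_mem_sup ?_ ?_
    · rw [mem_restrictTotalDegree] at hq ⊢
      refine (totalDegree_mul _ _).trans ?_
      rw [totalDegree_X]
      omega
    · exact hV j g hg

theorem Stable.succ {s : ℕ} {I : Ideal (MvPolynomial (Fin s) ℂ)} {k : ℕ} (h : Stable I k) :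
    Stable I (k + 1) :=
  restrictTotalDegree_succ_le (fun _ _ hv => I.mul_mem_left _ hv) h

theorem Stable.mono {s : ℕ} {I : Ideal (MvPolynomial (Fin s) ℂ)} {k l : ℕ} (h : Stable I k)
    (hkl : k ≤ l) : Stable I l := by
  induction l, hkl using Nat.le_induction with
  | base => exact h
  | succ l _ ih => exact ih.succ

theorem Stable.le_sup {s : ℕ} {I : Ideal (MvPolynomial (Fin s) ℂ)} {k : ℕ} (h : Stable I k)
    (l : ℕ) : restrictTotalDegree (Fin s) ℂ l ≤
      restrictTotalDegree (Fin s) ℂ k ⊔ I.restrictScalars ℂ := by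
  rcases le_total l k with hl | hl
  · exact (restrictTotalDegree_mono hl).trans le_sup_left
  · induction l, hl using Nat.le_induction with
    | base => exact le_sup_left
    | succ l hl ih => exact (h.mono hl).trans (sup_le ih le_sup_right)

theorem Stable.exists_sub_mem {s : ℕ} {I : Ideal (MvPolynomial (Fin s) ℂ)} {k : ℕ}
    (h : Stable I k) (p : MvPolynomial (Fin s) ℂ) :
    ∃ q, q.totalDegree ≤ k ∧ p - q ∈ I := by
  obtain ⟨q, hq, g, hg, rfl⟩ := Submodule.mem_sup.1
    (h.le_sup p.totalDegree ((mem_restrictTotalDegree _ _ _).2 le_rfl))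
  exact ⟨q, (mem_restrictTotalDegree _ _ _).1 hq, by simpa using hg⟩

/-- Every form of degree `l > k` is the component of degree `l` of some element of `I` of
degree at most `l`. -/
theorem Stable.exists_mem {s : ℕ} {I : Ideal (MvPolynomial (Fin s) ℂ)} {k l : ℕ}
    (h : Stable I k) (hl : k < l) {p : MvPolynomial (Fin s) ℂ} (hp : p.totalDegree ≤ l) :
    ∃ g ∈ I, g.totalDegree ≤ l ∧ homogeneousComponent l g = homogeneousComponent l p := by
  obtain ⟨q, hq, hpq⟩ := h.exists_sub_mem p
  refine ⟨p - q, hpq, (totalDegree_sub _ _).trans (max_le hp (by omega)), ?_⟩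
  rw [map_sub, homogeneousComponent_eq_zero l q (by omega), sub_zero]

/-- Above a stable degree every form is the leading form of an element of the ideal, so the leading
form of a reduced polynomial of larger degree would be orthogonal to itself. -/
theorem Stable.totalDegree_le {s : ℕ} {I : Ideal (MvPolynomial (Fin s) ℂ)} {k : ℕ}
    (h : Stable I k) {r : MvPolynomial (Fin s) ℂ} (hr : IsReduced I r) : r.totalDegree ≤ k := by
  by_contra hk
  push Not at hk
  obtain ⟨g, hg, hgd, hgr⟩ := h.exists_mem hk (le_refl r.totalDegree)
  have := isReduced_iff.1 hr _ g hg hgd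
  rw [hgr] at this
  have h0 : leadingForm r = 0 := coeffInner_self_eq_zero this
  refine leadingForm_ne_zero ?_ h0
  rintro rfl
  simp at hk

/-! ### Leading forms of the ideal and their orthogonal complements. -/

theorem isReduced_of_form {s : ℕ} {I : Ideal (MvPolynomial (Fin s) ℂ)} {k : ℕ}
    {u : HIdx s k → ℂ}
    (h : ∀ q ∈ I, q.totalDegree ≤ k → star (formVec k q) ⬝ᵥ u = 0) :
    IsReduced I (toForm u) := by
  rw [isReduced_iff]
  intro l q hq hl
  rw [homogeneousComponent_toForm]
  split_ifs with hlk
  · subst hlk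
    rw [← toForm_formVec q, coeffInner_toForm]
    exact h q hq hl
  · simp [coeffInner]

theorem exists_orthogonal {ι : Type*} [Fintype ι] [DecidableEq ι] {V : Submodule ℂ (ι → ℂ)}
    (hV : V < ⊤) : ∃ u : ι → ℂ, u ≠ 0 ∧ ∀ v ∈ V, star v ⬝ᵥ u = 0 := by
  obtain ⟨f, hf, hVf⟩ := Submodule.exists_le_ker_of_lt_top V hV
  -- A functional vanishing on `V` is pairing with its vector of values on the unit vectors;
  -- conjugating that vector turns the pairing into the inner product.
  refine ⟨fun i => star (f (Pi.single i 1)), ?_, fun v hv => ?_⟩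
  · intro h
    apply hf
    refine LinearMap.pi_ext' fun i => LinearMap.ext_ring ?_
    have := congrFun h i
    simpa using this
  · have h1 : f v = 0 := hVf hv
    have h2 : f v = ∑ i, v i * f (Pi.single i 1) := by
      conv_lhs => rw [pi_eq_sum_univ' v, map_sum]
      refine Finset.sum_congr rfl fun i _ => ?_
      rw [map_smul, smul_eq_mul]
    rw [h1] at h2
    have := congrArg star h2
    simp only [star_zero, star_sum, star_mul'] at this
    exact this.symm

/-- The leading parts of degree `k` of the polynomials in `I` of degree at most `k`. -/
def leadingSpace {s : ℕ} (I : Ideal (MvPolynomial (Fin s) ℂ)) (k : ℕ) :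
    Submodule ℂ (HIdx s k → ℂ) :=
  ((restrictTotalDegree (Fin s) ℂ k ⊓ I.restrictScalars ℂ).map (homogeneousComponent k)).comap
    (toFormₗ s k)

theorem mem_leadingSpace {s : ℕ} {I : Ideal (MvPolynomial (Fin s) ℂ)} {k : ℕ}
    {v : HIdx s k → ℂ} : v ∈ leadingSpace I k ↔
      ∃ q ∈ I, q.totalDegree ≤ k ∧ homogeneousComponent k q = toForm v := by
  simp only [leadingSpace, Submodule.mem_comap, Submodule.mem_map, Submodule.mem_inf,
    mem_restrictTotalDegree, Submodule.restrictScalars_mem, toFormₗ_apply]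
  constructor
  · rintro ⟨q, ⟨h1, h2⟩, h3⟩; exact ⟨q, h2, h1, h3⟩
  · rintro ⟨q, h1, h2, h3⟩; exact ⟨q, ⟨h2, h1⟩, h3⟩

theorem formVec_mem_leadingSpace {s : ℕ} {I : Ideal (MvPolynomial (Fin s) ℂ)} {k : ℕ}
    {q : MvPolynomial (Fin s) ℂ} (hq : q ∈ I) (hk : q.totalDegree ≤ k) :
    formVec k q ∈ leadingSpace I k :=
  mem_leadingSpace.2 ⟨q, hq, hk, (toForm_formVec q).symm⟩

/-- An element of the ideal with the same top form as `p` can be subtracted from `p`, which lowers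
the degree. -/
theorem stable_of_leadingSpace_eq_top {s : ℕ} {I : Ideal (MvPolynomial (Fin s) ℂ)} {k : ℕ}
    (h : leadingSpace I (k + 1) = ⊤) : Stable I k := by
  intro p hp
  rw [mem_restrictTotalDegree] at hp
  have hm : formVec (k + 1) p ∈ leadingSpace I (k + 1) := h ▸ Submodule.mem_top
  obtain ⟨q, hq, hqd, hqp⟩ := mem_leadingSpace.1 hm
  rw [toForm_formVec] at hqp
  refine Submodule.mem_sup.2 ⟨p - q, ?_, q, hq, sub_add_cancel _ _⟩
  rw [mem_restrictTotalDegree]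
  refine totalDegree_le_of_homogeneousComponent_eq_zero
    ((totalDegree_sub _ _).trans (max_le hp hqd)) ?_
  rw [map_sub, hqp, sub_self]

theorem exists_isReduced_totalDegree_eq {s : ℕ} {I : Ideal (MvPolynomial (Fin s) ℂ)} {k : ℕ}
    (h : leadingSpace I k ≠ ⊤) : ∃ r, IsReduced I r ∧ r.totalDegree = k := by
  classical
  obtain ⟨u, hu, huV⟩ := exists_orthogonal (lt_top_iff_ne_top.2 h)
  refine ⟨toForm u, isReduced_of_form fun q hq hk => huV _ (formVec_mem_leadingSpace hq hk), ?_⟩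
  refine (isHomogeneous_toForm u).totalDegree fun h0 => hu (toForm_injective s k ?_)
  rw [h0, toForm_zero]

/-! ### Evaluation at the points -/

/-- Evaluation of polynomials at the points `e^ω`. -/
def evalPts {s : ℕ} (Ω : Finset (Fin s → ℂ)) : MvPolynomial (Fin s) ℂ →ₗ[ℂ] (Ω → ℂ) :=
  LinearMap.pi fun ω => (aeval (expPt ω.1) : MvPolynomial (Fin s) ℂ →ₐ[ℂ] ℂ).toLinearMap

theorem evalPts_apply {s : ℕ} (Ω : Finset (Fin s → ℂ)) (p : MvPolynomial (Fin s) ℂ) (ω : Ω) :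
    evalPts Ω p ω = eval (expPt ω.1) p := rfl

theorem mem_idealOf {s : ℕ} {Ω : Finset (Fin s → ℂ)} {p : MvPolynomial (Fin s) ℂ} :
    p ∈ idealOf Ω ↔ ∀ ω ∈ Ω, eval (expPt ω) p = 0 := by
  rw [idealOf, mem_vanishingIdeal_iff, Set.forall_mem_image]
  rfl

theorem ker_evalPts {s : ℕ} (Ω : Finset (Fin s → ℂ)) :
    LinearMap.ker (evalPts Ω) = (idealOf Ω).restrictScalars ℂ := by
  ext p
  rw [LinearMap.mem_ker, Submodule.restrictScalars_mem, mem_idealOf, funext_iff]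
  simp [evalPts_apply]

/-- The ideal is the kernel of evaluation, so a containment modulo the ideal is a containment of
images. These are finite-dimensional and can be compared with ranks. -/
theorem stable_iff_map_evalPts {s : ℕ} {Ω : Finset (Fin s → ℂ)} {k : ℕ} :
    Stable (idealOf Ω) k ↔ (restrictTotalDegree (Fin s) ℂ k).map (evalPts Ω) =
      (restrictTotalDegree (Fin s) ℂ (k + 1)).map (evalPts Ω) := by
  rw [Stable, ← ker_evalPts, ← LinearMap.map_le_map_iff]
  refine ⟨fun h => le_antisymm (Submodule.map_mono (restrictTotalDegree_mono (by omega))) h,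
    fun h => h.ge⟩

theorem exists_stable {s : ℕ} {Ω : Finset (Fin s → ℂ)} (hne : Ω.Nonempty) :
    ∃ k < Ω.card, Stable (idealOf Ω) k := by
  by_contra! h
  -- Without a stable degree below `Ω.card` the image dimension is at least 1 in degree 0 and grows
  -- by at least 1 each time, so in degree `Ω.card` it exceeds the dimension of `Ω → ℂ`.
  have key : ∀ k ≤ Ω.card,
      k + 1 ≤ Module.finrank ℂ ((restrictTotalDegree (Fin s) ℂ k).map (evalPts Ω)) := by
    intro k hk
    induction k with
    | zero =>
      rw [Nat.one_le_iff_ne_zero, ne_eq, Submodule.finrank_eq_zero]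
      obtain ⟨ω, hω⟩ := hne
      intro h0
      have h1 : evalPts Ω 1 ∈ (restrictTotalDegree (Fin s) ℂ 0).map (evalPts Ω) :=
        Submodule.mem_map_of_mem ((mem_restrictTotalDegree _ _ _).2 (by simp))
      rw [h0, Submodule.mem_bot] at h1
      have := congrFun h1 ⟨ω, hω⟩
      simp [evalPts_apply] at this
    | succ k ih =>
      refine (ih (by omega)).trans_lt (Submodule.finrank_lt_finrank_of_lt ?_)
      refine lt_of_le_of_ne (Submodule.map_mono (restrictTotalDegree_mono (by omega))) ?_
      exact fun h' => h k (by omega) (stable_iff_map_evalPts.2 h')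
  have h1 := key _ le_rfl
  have h2 := Submodule.finrank_le ((restrictTotalDegree (Fin s) ℂ Ω.card).map (evalPts Ω))
  rw [Module.finrank_fintype_fun_eq_card, Fintype.card_coe] at h2
  omega

/-- A polynomial of degree zero in the ideal vanishes. -/
theorem eq_zero_of_mem_idealOf_of_totalDegree {s : ℕ} {Ω : Finset (Fin s → ℂ)}
    (hne : Ω.Nonempty) {p : MvPolynomial (Fin s) ℂ} (hp : p ∈ idealOf Ω)
    (hd : p.totalDegree = 0) : p = 0 := by
  obtain ⟨ω, hω⟩ := hne
  rw [totalDegree_eq_zero_iff_eq_C] at hd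
  have := mem_idealOf.1 hp ω hω
  rw [hd, eval_C] at this
  rw [hd, this, C_0]

theorem leadingSpace_zero_ne_top {s : ℕ} {Ω : Finset (Fin s → ℂ)} (hne : Ω.Nonempty) :
    leadingSpace (idealOf Ω) 0 ≠ ⊤ := by
  intro h
  have hm : formVec 0 1 ∈ leadingSpace (idealOf Ω) 0 := h ▸ Submodule.mem_top
  obtain ⟨q, hq, hqd, hqp⟩ := mem_leadingSpace.1 hm
  rw [eq_zero_of_mem_idealOf_of_totalDegree hne hq (Nat.le_zero.1 hqd), toForm_formVec] at hqp
  simp at hqp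

/-- The link between the stopping rule and the normal forms. Reduced polynomials have degree at most
any stable degree. The least stable degree is attained, because the failure of stability one degree
lower leaves a nonzero form orthogonal to all leading forms; in degree 0 the constants play this
role. -/
theorem exists_isLeast_stable {s : ℕ} {Ω : Finset (Fin s → ℂ)} (hne : Ω.Nonempty) :
    ∃ m < Ω.card, Stable (idealOf Ω) m ∧ (∀ k < m, ¬ Stable (idealOf Ω) k) ∧
      IsGreatest {d | ∃ r ∈ normalFormSpace (idealOf Ω), r.totalDegree = d} m := by
  classical
  have hex := exists_stable hne
  have hex' : ∃ k, Stable (idealOf Ω) k := ⟨_, hex.choose_spec.2⟩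
  have hst := Nat.find_spec hex'
  refine ⟨Nat.find hex', (Nat.find_min' hex' hex.choose_spec.2).trans_lt hex.choose_spec.1,
    hst, fun k hk => Nat.find_min hex' hk, ?_, ?_⟩
  · have : leadingSpace (idealOf Ω) (Nat.find hex') ≠ ⊤ := by
      rcases hk : Nat.find hex' with - | k
      · exact leadingSpace_zero_ne_top hne
      · intro h
        exact Nat.find_min hex' (by omega : k < Nat.find hex') (stable_of_leadingSpace_eq_top h)
    obtain ⟨r, hr, hd⟩ := exists_isReduced_totalDegree_eq this
    exact ⟨r, mem_normalFormSpace.2 hr, hd⟩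
  · rintro d ⟨r, hr, rfl⟩
    exact hst.totalDegree_le (mem_normalFormSpace.1 hr)

theorem isGreatest_degN {s : ℕ} {Ω : Finset (Fin s → ℂ)} (hne : Ω.Nonempty) :
    IsGreatest {d | ∃ r ∈ normalFormSpace (idealOf Ω), r.totalDegree = d} (degN Ω) := by
  obtain ⟨m, -, -, -, h⟩ := exists_isLeast_stable hne
  rw [degN, h.csSup_eq]
  exact h

theorem degN_lt_card {s : ℕ} {Ω : Finset (Fin s → ℂ)} (hne : Ω.Nonempty) : degN Ω < Ω.card := by
  obtain ⟨m, hm, -, -, h⟩ := exists_isLeast_stable hne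
  rwa [degN, h.csSup_eq]

theorem stable_degN {s : ℕ} {Ω : Finset (Fin s → ℂ)} (hne : Ω.Nonempty) :
    Stable (idealOf Ω) (degN Ω) := by
  obtain ⟨m, -, hm, -, h⟩ := exists_isLeast_stable hne
  rwa [degN, h.csSup_eq]

theorem not_stable_of_lt_degN {s : ℕ} {Ω : Finset (Fin s → ℂ)} (hne : Ω.Nonempty) {k : ℕ}
    (hk : k < degN Ω) : ¬ Stable (idealOf Ω) k := by
  obtain ⟨m, -, -, hm, h⟩ := exists_isLeast_stable hne
  rw [degN, h.csSup_eq] at hk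
  exact hm k hk

theorem toFreq_eq_iff {s : ℕ} {ω ω' : Fin s → ℂ} : toFreq ω = toFreq ω' ↔ expPt ω = expPt ω' := by
  simp only [toFreq, expPt, funext_iff]
  refine forall_congr' fun j => ?_
  rw [Complex.exp_eq_exp_iff_exists_int]
  refine QuotientAddGroup.eq.trans ?_
  rw [AddSubgroup.mem_zmultiples_iff]
  constructor
  · rintro ⟨n, hn⟩
    refine ⟨-n, ?_⟩
    rw [zsmul_eq_mul] at hn
    push_cast
    linear_combination hn
  · rintro ⟨n, hn⟩
    refine ⟨-n, ?_⟩
    rw [zsmul_eq_mul]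
    push_cast
    linear_combination hn

/-- Polynomials that are the indicator functions of the points. -/
theorem exists_lagrange {s : ℕ} {Ω : Finset (Fin s → ℂ)}
    (hinj : Set.InjOn expPt (Ω : Set (Fin s → ℂ))) (ω : Fin s → ℂ) (hω : ω ∈ Ω) :
    ∃ p : MvPolynomial (Fin s) ℂ, eval (expPt ω) p = 1 ∧
      ∀ ω' ∈ Ω, ω' ≠ ω → eval (expPt ω') p = 0 := by
  classical
  have h : ∀ ω' ∈ Ω.erase ω, ∃ p : MvPolynomial (Fin s) ℂ,
      eval (expPt ω) p = 1 ∧ eval (expPt ω') p = 0 := fun ω' h' => by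
    obtain ⟨j, hj⟩ : ∃ j, expPt ω j ≠ expPt ω' j := by
      by_contra! h
      exact (Finset.mem_erase.1 h').1 (hinj (Finset.mem_erase.1 h').2 hω (funext h).symm)
    refine ⟨C ((expPt ω j - expPt ω' j)⁻¹) * (X j - C (expPt ω' j)), ?_, by simp⟩
    simp only [map_mul, map_sub, eval_C, eval_X]
    exact inv_mul_cancel₀ (sub_ne_zero.2 hj)
  choose! p hp hp' using h
  refine ⟨∏ ω' ∈ Ω.erase ω, p ω', ?_, fun ω' h' hne => ?_⟩
  · rw [eval_prod]
    exact Finset.prod_eq_one hp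
  · rw [eval_prod]
    exact Finset.prod_eq_zero (Finset.mem_erase.2 ⟨hne, h'⟩) (hp' _ (Finset.mem_erase.2 ⟨hne, h'⟩))

theorem evalPts_surjective {s : ℕ} {Ω : Finset (Fin s → ℂ)}
    (hinj : Set.InjOn expPt (Ω : Set (Fin s → ℂ))) : Function.Surjective (evalPts Ω) := by
  classical
  choose! p hp hp' using exists_lagrange hinj
  intro y
  refine ⟨∑ ω : Ω, y ω • p ω, ?_⟩
  ext ω
  rw [map_sum, Finset.sum_apply, Finset.sum_eq_single ω]
  · simp [evalPts_apply, hp ω ω.2]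
  · intro ω' _ hne
    simp [evalPts_apply, hp' ω' ω'.2 ω ω.2 fun h => hne (Subtype.ext h.symm)]
  · simp

/-- Interpolation is possible in some degree, and stability reduces any interpolant to degree at
most `degN Ω` without changing its values. -/
theorem map_evalPts_eq_top {s : ℕ} {Ω : Finset (Fin s → ℂ)} (hne : Ω.Nonempty)
    (hinj : Set.InjOn expPt (Ω : Set (Fin s → ℂ))) {n : ℕ} (hn : degN Ω ≤ n) :
    (restrictTotalDegree (Fin s) ℂ n).map (evalPts Ω) = ⊤ := by
  refine eq_top_iff.2 fun y _ => ?_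
  obtain ⟨p, rfl⟩ := evalPts_surjective hinj y
  obtain ⟨q, hq, hpq⟩ := (stable_degN hne).exists_sub_mem p
  refine ⟨q, (mem_restrictTotalDegree _ _ _).2 (hq.trans hn), ?_⟩
  have : p - q ∈ LinearMap.ker (evalPts Ω) := by rw [ker_evalPts]; exact hpq
  rw [LinearMap.mem_ker, map_sub, sub_eq_zero] at this
  exact this.symm

/-! ### QR factorizations and pseudoinverses -/

theorem fromCols_mul_fromRows_zero {m p q : Type*} [Fintype p] [Fintype q]
    (Q₁ : Matrix m p ℂ) (Q₂ : Matrix m q ℂ) (R : Matrix p p ℂ) :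
    (Matrix.fromCols Q₁ Q₂ * (Matrix.fromRows R 0 : Matrix (p ⊕ q) p ℂ) : Matrix m p ℂ) =
      Q₁ * R := by
  rw [Matrix.fromCols_mul_fromRows, Matrix.mul_zero, add_zero]

theorem exists_isQR {m : Type*} [Fintype m] [DecidableEq m] {p q : ℕ}
    (hm : Fintype.card m = p + q) (A : Matrix m (Fin p) ℂ) :
    ∃ (Q₁ : Matrix m (Fin p) ℂ) (Q₂ : Matrix m (Fin q) ℂ) (R : Matrix (Fin p) (Fin p) ℂ),
      IsQR A Q₁ Q₂ R := by
  -- Gram–Schmidt is run on the columns followed by `q` zero vectors, so that the family has as many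
  -- members as the dimension. The orthonormal basis fills the gaps, hence the columns need not be
  -- independent.
  let f : Fin (p + q) → EuclideanSpace ℂ m :=
    Fin.addCases (fun i => WithLp.toLp 2 (A.col i)) (fun _ => 0)
  have hfin : Module.finrank ℂ (EuclideanSpace ℂ m) = Fintype.card (Fin (p + q)) := by
    rw [finrank_euclideanSpace, hm, Fintype.card_fin]
  let b := InnerProductSpace.gramSchmidtOrthonormalBasis hfin f
  have hb : ∀ {i j : Fin (p + q)}, i < j → inner ℂ (b j) (f i) = 0 := fun h =>
    InnerProductSpace.gramSchmidtOrthonormalBasis_inv_triangular hfin f h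
  let U : Matrix m (Fin (p + q)) ℂ := Matrix.of fun α i => b i α
  have hU : Uᴴ * U = 1 := by
    ext i j
    rw [Matrix.mul_apply, Matrix.one_apply, ← orthonormal_iff_ite.1 b.orthonormal i j,
      PiLp.inner_apply]
    refine Finset.sum_congr rfl fun α _ => ?_
    rw [Matrix.conjTranspose_apply, RCLike.inner_apply, mul_comm]
    rfl
  let Q₁ : Matrix m (Fin p) ℂ := U.submatrix id (Fin.castAdd q)
  let Q₂ : Matrix m (Fin q) ℂ := U.submatrix id (Fin.natAdd p)
  have hQ : Matrix.fromCols Q₁ Q₂ = U.submatrix id finSumFinEquiv := by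
    ext α (i | i) <;> simp [Q₁, Q₂]
  have hiso : (Matrix.fromCols Q₁ Q₂)ᴴ * Matrix.fromCols Q₁ Q₂ = 1 := by
    rw [hQ, Matrix.conjTranspose_submatrix,
      Matrix.submatrix_mul Uᴴ U finSumFinEquiv id finSumFinEquiv Function.bijective_id |>.symm, hU,
      Matrix.submatrix_one_equiv]
  refine ⟨Q₁, Q₂, Matrix.of fun i j => inner ℂ (b (Fin.castAdd q i)) (f (Fin.castAdd q j)),
    ?_, hiso, ?_, ?_⟩
  · refine Eq.trans ?_ (fromCols_mul_fromRows_zero Q₁ Q₂ _).symm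
    ext α j
    have h := b.sum_repr' (f (Fin.castAdd q j))
    -- The last `q` basis vectors come after every column and are orthogonal to all of them; this is
    -- the zero block below `R`.
    have h0 : ∑ i : Fin q, inner ℂ (b (Fin.natAdd p i)) (f (Fin.castAdd q j)) •
        b (Fin.natAdd p i) = 0 := by
      refine Finset.sum_eq_zero fun i _ => ?_
      rw [hb (Fin.lt_def.2 (by simp; omega)), zero_smul]
    rw [Fin.sum_univ_add, h0, add_zero] at h
    have hf : (f (Fin.castAdd q j)) α = A α j := by simp [f]
    rw [← hf, ← h, Matrix.mul_apply, WithLp.ofLp_sum, Finset.sum_apply]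
    refine Finset.sum_congr rfl fun i _ => ?_
    rw [Matrix.of_apply, mul_comm]
    rfl
  · refine (Matrix.mul_eq_one_comm_of_card_eq _ _ _ ?_).1 hiso
    rw [hm, Fintype.card_sum, Fintype.card_fin, Fintype.card_fin]
  · intro i j hij
    exact hb (Fin.lt_def.2 (by simpa using hij))

namespace IsQR

variable {m p q : Type*} [Fintype m] [DecidableEq m] [Fintype p] [DecidableEq p]
    [LinearOrder p] [Fintype q] [DecidableEq q]
    {A : Matrix m p ℂ} {Q₁ : Matrix m p ℂ} {Q₂ : Matrix m q ℂ} {R : Matrix p p ℂ}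

theorem eq_mul (h : IsQR A Q₁ Q₂ R) : A = Q₁ * R :=
  h.factor.trans (fromCols_mul_fromRows_zero Q₁ Q₂ R)

theorem fromBlocks_eq (h : IsQR A Q₁ Q₂ R) :
    Matrix.fromBlocks (Q₁ᴴ * Q₁) (Q₁ᴴ * Q₂) (Q₂ᴴ * Q₁) (Q₂ᴴ * Q₂) =
      Matrix.fromBlocks 1 0 0 1 := by
  rw [Matrix.fromBlocks_one, ← h.isometry,
    Matrix.conjTranspose_fromCols_eq_fromRows_conjTranspose, Matrix.fromRows_mul_fromCols]

theorem left_left (h : IsQR A Q₁ Q₂ R) : Q₁ᴴ * Q₁ = 1 :=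
  (Matrix.fromBlocks_inj.1 h.fromBlocks_eq).1

theorem left_right (h : IsQR A Q₁ Q₂ R) : Q₁ᴴ * Q₂ = 0 :=
  (Matrix.fromBlocks_inj.1 h.fromBlocks_eq).2.1

theorem right_left (h : IsQR A Q₁ Q₂ R) : Q₂ᴴ * Q₁ = 0 :=
  (Matrix.fromBlocks_inj.1 h.fromBlocks_eq).2.2.1

theorem right_right (h : IsQR A Q₁ Q₂ R) : Q₂ᴴ * Q₂ = 1 :=
  (Matrix.fromBlocks_inj.1 h.fromBlocks_eq).2.2.2

theorem add_eq_one (h : IsQR A Q₁ Q₂ R) : Q₁ * Q₁ᴴ + Q₂ * Q₂ᴴ = 1 := by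
  rw [← h.unitary, Matrix.conjTranspose_fromCols_eq_fromRows_conjTranspose,
    Matrix.fromCols_mul_fromRows]

theorem isUnit_det (h : IsQR A Q₁ Q₂ R) (hA : Function.Injective A.mulVec) : IsUnit R.det := by
  rw [← Matrix.isUnit_iff_isUnit_det, ← Matrix.mulVec_injective_iff_isUnit]
  intro x y hxy
  apply hA
  rw [h.eq_mul, ← Matrix.mulVec_mulVec, ← Matrix.mulVec_mulVec, hxy]

end IsQR

-- For injective `A` the Gram matrix `Aᴴ * A` has the same kernel as `A`, so it is invertible and
-- the familiar formula `(Aᴴ * A)⁻¹ * Aᴴ` applies.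
open scoped ComplexOrder in
theorem exists_isMoorePenrose {m n : Type*} [Fintype m] [Fintype n] [DecidableEq n]
    {A : Matrix m n ℂ} (hA : Function.Injective A.mulVec) :
    ∃ B : Matrix n m ℂ, IsMoorePenrose A B := by
  have hu : IsUnit (Aᴴ * A).det := by
    rw [← Matrix.isUnit_iff_isUnit_det, ← Matrix.mulVec_injective_iff_isUnit]
    rw [← Matrix.coe_mulVecLin, ← LinearMap.ker_eq_bot, Matrix.ker_mulVecLin_conjTranspose_mul_self,
      LinearMap.ker_eq_bot]
    exact hA
  have h1 : (Aᴴ * A)⁻¹ * Aᴴ * A = 1 := by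
    rw [Matrix.mul_assoc, Matrix.nonsing_inv_mul _ hu]
  refine ⟨(Aᴴ * A)⁻¹ * Aᴴ, ?_, ?_, ?_, ?_⟩
  · rw [Matrix.mul_assoc, h1, Matrix.mul_one]
  · rw [h1, Matrix.one_mul]
  · simp only [Matrix.conjTranspose_mul, Matrix.conjTranspose_nonsing_inv,
      Matrix.conjTranspose_conjTranspose, Matrix.mul_assoc]
  · rw [h1, Matrix.conjTranspose_one]

/-! ### Graded bases of the ideal -/

/-- The columns of `B` form a basis of `W`. -/
def IsColBasis {m n : Type*} [Fintype n] (W : Submodule ℂ (m → ℂ)) (B : Matrix m n ℂ) : Prop :=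
  Function.Injective B.mulVec ∧ LinearMap.range B.mulVecLin = W

theorem isKernelBasis_iff {m n ι : Type*} [Fintype n] [Fintype ι] {A : Matrix m n ℂ}
    {B : Matrix n ι ℂ} : IsKernelBasis A B ↔ IsColBasis (LinearMap.ker A.mulVecLin) B := by
  rw [IsKernelBasis, IsColBasis, Matrix.mulVec_injective_iff, Matrix.range_mulVecLin]

theorem IsColBasis.mem {m n : Type*} [Fintype n] {W : Submodule ℂ (m → ℂ)} {B : Matrix m n ℂ}
    (h : IsColBasis W B) (x : n → ℂ) : B *ᵥ x ∈ W := by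
  rw [← h.2]; exact ⟨x, rfl⟩

theorem IsColBasis.exists_eq {m n : Type*} [Fintype n] {W : Submodule ℂ (m → ℂ)}
    {B : Matrix m n ℂ} (h : IsColBasis W B) {v : m → ℂ} (hv : v ∈ W) : ∃ x, B *ᵥ x = v := by
  rw [← h.2] at hv; exact hv

theorem exists_isColBasis {m : Type*} [Finite m] (W : Submodule ℂ (m → ℂ)) {k : ℕ}
    (hk : Module.finrank ℂ W = k) : ∃ B : Matrix m (Fin k) ℂ, IsColBasis W B := by
  let b := Module.finBasisOfFinrankEq ℂ W hk
  refine ⟨Matrix.of fun α i => (b i).1 α, ?_, ?_⟩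
  · rw [Matrix.mulVec_injective_iff]
    exact b.linearIndependent.map' W.subtype W.ker_subtype
  · rw [Matrix.range_mulVecLin]
    have : Set.range (Matrix.of fun α i => (b i).1 α).col = W.subtype '' Set.range b := by
      rw [← Set.range_comp]; rfl
    rw [this, ← Submodule.map_span, b.span_eq, Submodule.map_top, Submodule.range_subtype]

/-- The coefficient vectors of the polynomials of degree at most `k` in `I`. -/
def idealVecs {s : ℕ} (I : Ideal (MvPolynomial (Fin s) ℂ)) (k : ℕ) : Submodule ℂ (MIdx s k → ℂ) :=
  (I.restrictScalars ℂ).comap (toPolyₗ s k)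

theorem mem_idealVecs {s k : ℕ} {I : Ideal (MvPolynomial (Fin s) ℂ)} {v : MIdx s k → ℂ} :
    v ∈ idealVecs I k ↔ toPoly v ∈ I := Iff.rfl

/-! ### Extending a basis of the ideal by one degree. -/

section Step

variable {s k : ℕ} {I : Ideal (MvPolynomial (Fin s) ℂ)}

theorem pad_mulVec_eq_zero {ι : Type*} [Fintype ι] {K : Matrix (MIdx s k) ι ℂ}
    {x : ι → ℂ} (h : pad (k + 1) K *ᵥ x = 0) : K *ᵥ x = 0 := by
  apply toPoly_injective s k
  rw [← toPoly_pad (Nat.le_succ k), h, toPoly_zero, toPoly_zero]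

/-- The matrix `Pinv * pad (k + 1) K` contains the coordinates of the columns of `K` in the basis
`Pt`. It is injective, so `R` is invertible and so is `[Q₁ R, Q₂]`. The matrix in question is `Pt`
times this change of basis. -/
theorem isColBasis_fromCols {κ π τ : Type*} [Fintype κ] [DecidableEq κ] [LinearOrder κ]
    [Fintype π] [DecidableEq π] [Fintype τ] [DecidableEq τ]
    {K : Matrix (MIdx s k) κ ℂ} {Pt : Matrix (MIdx s (k + 1)) τ ℂ}
    {Pinv : Matrix τ (MIdx s (k + 1)) ℂ} {Q₁ : Matrix τ κ ℂ} {Q₂ : Matrix τ π ℂ}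
    {R : Matrix κ κ ℂ} (hK : IsColBasis (idealVecs I k) K)
    (hPt : IsColBasis (idealVecs I (k + 1)) Pt) (hinv : IsMoorePenrose Pt Pinv)
    (hQ : IsQR (Pinv * pad (k + 1) K) Q₁ Q₂ R) :
    IsColBasis (idealVecs I (k + 1)) (Matrix.fromCols (pad (k + 1) K) (Pt * Q₂)) := by
  have hX : Pt * (Pinv * pad (k + 1) K) = pad (k + 1) K := by
    refine Matrix.ext_of_mulVec_single fun i => ?_
    have hmem : pad (k + 1) K *ᵥ Pi.single i 1 ∈ idealVecs I (k + 1) := by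
      rw [mem_idealVecs, toPoly_pad (Nat.le_succ k)]
      exact hK.mem _
    obtain ⟨y, hy⟩ := hPt.exists_eq hmem
    rw [← Matrix.mulVec_mulVec, ← Matrix.mulVec_mulVec, ← hy, Matrix.mulVec_mulVec,
      Matrix.mulVec_mulVec, hinv.left]
  have hXinj : Function.Injective (Pinv * pad (k + 1) K).mulVec := by
    rw [← Matrix.coe_mulVecLin, injective_iff_map_eq_zero]
    intro x hx
    rw [Matrix.mulVecLin_apply] at hx
    have : pad (k + 1) K *ᵥ x = 0 := by
      rw [← hX, ← Matrix.mulVec_mulVec, hx, Matrix.mulVec_zero]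
    exact hK.1 ((pad_mulVec_eq_zero this).trans (Matrix.mulVec_zero K).symm)
  have hR := hQ.isUnit_det hXinj
  have hmul : Matrix.fromCols (pad (k + 1) K) (Pt * Q₂) = Pt * Matrix.fromCols (Q₁ * R) Q₂ := by
    rw [Matrix.mul_fromCols, ← hQ.eq_mul, hX]
  -- The rows `R⁻¹ Q₁ᴴ` and `Q₂ᴴ` form the inverse of `[Q₁ R, Q₂]`.
  have hl : Matrix.fromRows (R⁻¹ * Q₁ᴴ) Q₂ᴴ * Matrix.fromCols (Q₁ * R) Q₂ = 1 := by
    rw [Matrix.fromRows_mul_fromCols, ← Matrix.mul_assoc Q₂ᴴ, hQ.right_left, hQ.right_right,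
      Matrix.mul_assoc _ _ Q₂, hQ.left_right, Matrix.mul_assoc R⁻¹, ← Matrix.mul_assoc Q₁ᴴ,
      hQ.left_left, Matrix.one_mul, Matrix.nonsing_inv_mul _ hR, Matrix.zero_mul,
      Matrix.mul_zero, Matrix.fromBlocks_one]
  have hr : Matrix.fromCols (Q₁ * R) Q₂ * Matrix.fromRows (R⁻¹ * Q₁ᴴ) Q₂ᴴ = 1 := by
    rw [Matrix.fromCols_mul_fromRows, Matrix.mul_assoc, ← Matrix.mul_assoc R,
      Matrix.mul_nonsing_inv _ hR, Matrix.one_mul, hQ.add_eq_one]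
  constructor
  · intro x y hxy
    rw [hmul] at hxy
    rw [← Matrix.mulVec_mulVec, ← Matrix.mulVec_mulVec] at hxy
    have := congrArg (Matrix.fromRows (R⁻¹ * Q₁ᴴ) Q₂ᴴ).mulVec (hPt.1 hxy)
    rwa [Matrix.mulVec_mulVec, Matrix.mulVec_mulVec, hl, Matrix.one_mulVec,
      Matrix.one_mulVec] at this
  · rw [hmul, ← hPt.2]
    refine le_antisymm ?_ ?_
    · rintro _ ⟨x, rfl⟩
      exact ⟨Matrix.fromCols (Q₁ * R) Q₂ *ᵥ x, (Matrix.mulVec_mulVec _ _ _)⟩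
    · rintro _ ⟨x, rfl⟩
      refine ⟨Matrix.fromRows (R⁻¹ * Q₁ᴴ) Q₂ᴴ *ᵥ x, ?_⟩
      rw [Matrix.mulVecLin_apply, Matrix.mulVec_mulVec, Matrix.mul_assoc, hr, Matrix.mul_one,
        Matrix.mulVecLin_apply]

/-- If the top parts of a combination of columns of `P` cancel, the combination lies in the ideal in
degree at most `k`, hence in the span of `K`; independence of `[K, P]` makes it trivial. Conversely,
the columns of `K` contribute nothing in degree `k + 1`, so `P` alone yields all leading parts. -/
theorem isColBasis_formPart {κ π : Type*} [Fintype κ] [Fintype π]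
    {K : Matrix (MIdx s k) κ ℂ} {P : Matrix (MIdx s (k + 1)) π ℂ}
    (hK : IsColBasis (idealVecs I k) K)
    (hP : IsColBasis (idealVecs I (k + 1)) (Matrix.fromCols (pad (k + 1) K) P)) :
    IsColBasis (leadingSpace I (k + 1)) (formPart (k + 1) P) := by
  have hPI : ∀ x, toPoly (P *ᵥ x) ∈ I := fun x => by
    have := hP.mem (Sum.elim 0 x)
    rwa [Matrix.fromCols_mulVec, mem_idealVecs, Sum.elim_comp_inl, Sum.elim_comp_inr,
      Matrix.mulVec_zero, zero_add] at this
  constructor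
  · rw [← Matrix.coe_mulVecLin, injective_iff_map_eq_zero]
    intro x hx
    rw [Matrix.mulVecLin_apply] at hx
    have h1 : (toPoly (P *ᵥ x)).totalDegree ≤ k := by
      refine totalDegree_le_of_homogeneousComponent_eq_zero (totalDegree_toPoly_le _) ?_
      rw [homogeneousComponent_toPoly, hx, toForm_zero]
    have h2 : coeffVec k (toPoly (P *ᵥ x)) ∈ idealVecs I k := by
      rw [mem_idealVecs, toPoly_coeffVec h1]
      exact hPI x
    obtain ⟨u, hu⟩ := hK.exists_eq h2
    have h3 : pad (k + 1) K *ᵥ u = P *ᵥ x := by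
      apply toPoly_injective
      rw [toPoly_pad (Nat.le_succ k), hu, toPoly_coeffVec h1]
    have h4 : Sum.elim (-u) x = 0 := by
      apply hP.1
      rw [Matrix.fromCols_mulVec, Sum.elim_comp_inl, Sum.elim_comp_inr, Matrix.mulVec_neg, h3,
        neg_add_cancel, Matrix.mulVec_zero]
    funext i
    exact congrFun h4 (Sum.inr i)
  · refine le_antisymm ?_ ?_
    · rintro _ ⟨x, rfl⟩
      rw [mem_leadingSpace]
      exact ⟨toPoly (P *ᵥ x), hPI x, totalDegree_toPoly_le _, homogeneousComponent_toPoly _ _ _⟩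
    · intro v hv
      obtain ⟨q, hq, hqd, hqv⟩ := mem_leadingSpace.1 hv
      have h2 : coeffVec (k + 1) q ∈ idealVecs I (k + 1) := by
        rw [mem_idealVecs, toPoly_coeffVec hqd]
        exact hq
      obtain ⟨u, hu⟩ := hP.exists_eq h2
      refine ⟨u ∘ Sum.inr, ?_⟩
      rw [Matrix.mulVecLin_apply]
      apply toForm_injective
      rw [← homogeneousComponent_toPoly, ← hqv, ← toPoly_coeffVec hqd, ← hu,
        Matrix.fromCols_mulVec, ← toPolyₗ_apply, ← toPolyₗ_apply, map_add, map_add]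
      rw [toPolyₗ_apply (pad (k + 1) K *ᵥ _), toPoly_pad (Nat.le_succ k),
        homogeneousComponent_eq_zero (k + 1) (toPoly (K *ᵥ _))
          (Nat.lt_succ_of_le (totalDegree_toPoly_le _)), zero_add]

end Step

theorem IsColBasis.submatrix {m n n' : Type*} [Fintype n] [Fintype n'] {W : Submodule ℂ (m → ℂ)}
    {B : Matrix m n ℂ} (h : IsColBasis W B) (e : n' ≃ n) :
    IsColBasis W (B.submatrix id e) := by
  have he : ∀ x, B.submatrix id e *ᵥ x = B *ᵥ (x ∘ e.symm) := fun x => by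
    rw [Matrix.submatrix_mulVec_equiv]; rfl
  constructor
  · intro x y hxy
    rw [he, he] at hxy
    exact e.symm.surjective.injective_comp_right (h.1 hxy)
  · rw [← h.2]
    refine le_antisymm ?_ ?_
    · rintro _ ⟨x, rfl⟩
      exact ⟨x ∘ e.symm, (he x).symm⟩
    · rintro _ ⟨x, rfl⟩
      refine ⟨x ∘ e, ?_⟩
      rw [Matrix.mulVecLin_apply, he]
      simp [Function.comp_assoc]

/-! ### The Hankel matrices of the samples -/

section Hankel

variable {s : ℕ} {Ω : Finset (Fin s → ℂ)} {c : (Fin s → ℂ) → ℂ} {n : ℕ} {a : (Fin s →₀ ℕ) → ℂ}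

theorem expSum_natCast (Ω : Finset (Fin s → ℂ)) (c : (Fin s → ℂ) → ℂ) (α : Fin s →₀ ℕ) :
    (expSum Ω c fun j => (α j : ℂ)) = ∑ ω ∈ Ω, c ω * ∏ j, expPt ω j ^ α j := by
  refine Finset.sum_congr rfl fun ω _ => ?_
  rw [Complex.exp_sum]
  congr 1
  refine Finset.prod_congr rfl fun j _ => ?_
  rw [mul_comm, Complex.exp_nat_mul, expPt]

theorem eval_toPoly {k : ℕ} (v : MIdx s k → ℂ) (z : Fin s → ℂ) :
    eval z (toPoly v) = ∑ β, v β * ∏ j, z j ^ β.1 j := by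
  rw [toPoly, map_sum]
  refine Finset.sum_congr rfl fun β _ => ?_
  rw [eval_monomial, Finsupp.prod_fintype _ _ fun _ => pow_zero _]

/-- The factorization of the Hankel matrix through the points. The bound `k ≤ n` keeps every `α + β`
within the sampled degrees `2 * n`. -/
theorem hankel_mulVec
    (ha : ∀ α : Fin s →₀ ℕ, α.degree ≤ 2 * n → a α = expSum Ω c fun j => (α j : ℂ))
    {k : ℕ} (hk : k ≤ n) (v : MIdx s k → ℂ) (α : MIdx s n) :
    (hankel a n k *ᵥ v) α =
      ∑ ω ∈ Ω, c ω * eval (expPt ω) (toPoly v) * ∏ j, expPt ω j ^ α.1 j := by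
  have h : ∀ β : MIdx s k, a (α.1 + β.1) =
      ∑ ω ∈ Ω, c ω * ((∏ j, expPt ω j ^ α.1 j) * ∏ j, expPt ω j ^ β.1 j) := fun β => by
    rw [ha, expSum_natCast]
    · simp only [Finsupp.add_apply, pow_add, Finset.prod_mul_distrib]
    · rw [map_add]
      have := α.2
      have := β.2
      omega
  simp only [Matrix.mulVec, dotProduct, hankel, Matrix.of_apply, h, Finset.sum_mul]
  rw [Finset.sum_comm]
  refine Finset.sum_congr rfl fun ω _ => ?_
  rw [eval_toPoly, Finset.mul_sum, Finset.sum_mul]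
  refine Finset.sum_congr rfl fun β _ => ?_
  ring

/-- Weights on the points that annihilate all monomials of degree at most `n ≥ deg N` vanish. -/
theorem weights_eq_zero (hne : Ω.Nonempty) (hinj : Set.InjOn expPt (Ω : Set (Fin s → ℂ)))
    (hn : degN Ω ≤ n) {y : (Fin s → ℂ) → ℂ}
    (hy : ∀ α : MIdx s n, ∑ ω ∈ Ω, y ω * ∏ j, expPt ω j ^ α.1 j = 0) :
    ∀ ω ∈ Ω, y ω = 0 := by
  classical
  have hq : ∀ q : MvPolynomial (Fin s) ℂ, q.totalDegree ≤ n →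
      ∑ ω ∈ Ω, y ω * eval (expPt ω) q = 0 := fun q hq => by
    rw [← toPoly_coeffVec hq]
    simp only [eval_toPoly, Finset.mul_sum]
    rw [Finset.sum_comm]
    refine Finset.sum_eq_zero fun β _ => ?_
    rw [← mul_zero (coeffVec n q β), ← hy β, Finset.mul_sum]
    refine Finset.sum_congr rfl fun ω _ => ?_
    ring
  intro ω hω
  -- A Lagrange polynomial of degree at most `n`; testing the weights against it isolates `y ω`.
  have hmem : (Pi.single ⟨ω, hω⟩ 1 : Ω → ℂ) ∈
      (restrictTotalDegree (Fin s) ℂ n).map (evalPts Ω) := by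
    rw [map_evalPts_eq_top hne hinj hn]
    exact Submodule.mem_top
  obtain ⟨q, hqd, hqe⟩ := hmem
  have h := hq q ((mem_restrictTotalDegree _ _ _).1 hqd)
  rw [Finset.sum_eq_single ω] at h
  · have := congrFun hqe ⟨ω, hω⟩
    rw [evalPts_apply, Pi.single_eq_same] at this
    rwa [this, mul_one] at h
  · intro ω' hω' hne'
    have := congrFun hqe ⟨ω', hω'⟩
    rw [evalPts_apply, Pi.single_eq_of_ne fun h => hne' (congrArg Subtype.val h)] at this
    rw [this, mul_zero]
  · exact fun h => (h hω).elim

/-- A kernel vector gives the weights `c ω * p(z_ω)`, which annihilate all monomials up to degree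
`n` and so vanish; since `c ω ≠ 0`, the polynomial `p` vanishes at every point. -/
theorem ker_hankel (hne : Ω.Nonempty) (hinj : Set.InjOn expPt (Ω : Set (Fin s → ℂ)))
    (hc : ∀ ω ∈ Ω, c ω ≠ 0) (hn : degN Ω ≤ n)
    (ha : ∀ α : Fin s →₀ ℕ, α.degree ≤ 2 * n → a α = expSum Ω c fun j => (α j : ℂ))
    {k : ℕ} (hk : k ≤ n) :
    LinearMap.ker (hankel a n k).mulVecLin = idealVecs (idealOf Ω) k := by
  ext v
  rw [LinearMap.mem_ker, Matrix.mulVecLin_apply, mem_idealVecs, mem_idealOf]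
  constructor
  · intro h ω hω
    have h' := weights_eq_zero hne hinj hn (y := fun ω => c ω * eval (expPt ω) (toPoly v))
      (fun α => by rw [← hankel_mulVec ha hk, h]; rfl) ω hω
    exact (mul_eq_zero.1 h').resolve_left (hc ω hω)
  · intro h
    ext α
    rw [hankel_mulVec ha hk]
    exact Finset.sum_eq_zero fun ω hω => by rw [h ω hω, mul_zero, zero_mul]

theorem range_toPolyₗ (s k : ℕ) :
    LinearMap.range (toPolyₗ s k) = restrictTotalDegree (Fin s) ℂ k := by
  ext p
  rw [mem_restrictTotalDegree]
  constructor
  · rintro ⟨v, rfl⟩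
    exact totalDegree_toPoly_le v
  · exact fun h => ⟨coeffVec k p, toPoly_coeffVec h⟩

/-- The Hankel matrix and evaluation in degree at most `k` have the same domain and the same kernel,
hence the same rank. -/
theorem rank_hankel (hne : Ω.Nonempty) (hinj : Set.InjOn expPt (Ω : Set (Fin s → ℂ)))
    (hc : ∀ ω ∈ Ω, c ω ≠ 0) (hn : degN Ω ≤ n)
    (ha : ∀ α : Fin s →₀ ℕ, α.degree ≤ 2 * n → a α = expSum Ω c fun j => (α j : ℂ))
    {k : ℕ} (hk : k ≤ n) :
    (hankel a n k).rank =
      Module.finrank ℂ ((restrictTotalDegree (Fin s) ℂ k).map (evalPts Ω)) := by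
  have h1 := LinearMap.finrank_range_add_finrank_ker (hankel a n k).mulVecLin
  have h2 := LinearMap.finrank_range_add_finrank_ker ((evalPts Ω).comp (toPolyₗ s k))
  have h3 : LinearMap.ker ((evalPts Ω).comp (toPolyₗ s k)) = idealVecs (idealOf Ω) k := by
    rw [LinearMap.ker_comp, ker_evalPts]
    rfl
  rw [ker_hankel hne hinj hc hn ha hk] at h1
  rw [h3, LinearMap.range_comp, range_toPolyₗ] at h2
  rw [Matrix.rank]
  omega

theorem rank_hankel_eq_iff (hne : Ω.Nonempty) (hinj : Set.InjOn expPt (Ω : Set (Fin s → ℂ)))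
    (hc : ∀ ω ∈ Ω, c ω ≠ 0) (hn : degN Ω ≤ n)
    (ha : ∀ α : Fin s →₀ ℕ, α.degree ≤ 2 * n → a α = expSum Ω c fun j => (α j : ℂ))
    {k : ℕ} (hk : k < n) :
    (hankel a n k).rank = (hankel a n (k + 1)).rank ↔ Stable (idealOf Ω) k := by
  rw [rank_hankel hne hinj hc hn ha hk.le, rank_hankel hne hinj hc hn ha (Nat.succ_le_of_lt hk),
    stable_iff_map_evalPts]
  refine ⟨fun h => ?_, fun h => by rw [h]⟩
  exact Submodule.eq_of_le_of_finrank_eq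
    (Submodule.map_mono (restrictTotalDegree_mono (Nat.le_succ k))) h

end Hankel

/-! ### The graded bases of a run -/

/-- The matrices computed in the loop of the algorithm, up to `k = M`, for the ideal `I`. -/
theorem isColBasis_gradedK {s : ℕ} {I : Ideal (MvPolynomial (Fin s) ℂ)}
    (h0 : idealVecs I 0 = ⊥) {w : ℕ → ℕ} (hw : w 0 = 0) {M : ℕ}
    {P : ∀ k, Matrix (MIdx s k) (Fin (w k)) ℂ}
    {Pt : ∀ k, Matrix (MIdx s k) (Fin (vol w k)) ℂ}
    {Pinv : ∀ k, Matrix (Fin (vol w k)) (MIdx s k) ℂ}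
    {XQ₁ : ∀ k, Matrix (Fin (vol w (k + 1))) (Fin (vol w k)) ℂ}
    {XQ₂ : ∀ k, Matrix (Fin (vol w (k + 1))) (Fin (w (k + 1))) ℂ}
    {XR : ∀ k, Matrix (Fin (vol w k)) (Fin (vol w k)) ℂ}
    (hPt : ∀ k ≤ M, IsColBasis (idealVecs I (k + 1)) (Pt (k + 1)))
    (hinv : ∀ k ≤ M, IsMoorePenrose (Pt (k + 1)) (Pinv (k + 1)))
    (hQ : ∀ k ≤ M, IsQR (Pinv (k + 1) * pad (k + 1) (gradedK P k)) (XQ₁ k) (XQ₂ k) (XR k))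
    (hP : ∀ k ≤ M, P (k + 1) = Pt (k + 1) * XQ₂ k) :
    ∀ k ≤ M + 1, IsColBasis (idealVecs I k) (gradedK P k) := by
  intro k hk
  induction k with
  | zero =>
    have : IsEmpty (Fin (vol w 0)) := by rw [vol, hw]; exact Fin.isEmpty'
    refine ⟨Function.injective_of_subsingleton _, ?_⟩
    rw [h0]
    refine eq_bot_iff.2 ?_
    rintro _ ⟨x, rfl⟩
    rw [Subsingleton.elim x 0, map_zero]
    exact Submodule.zero_mem _
  | succ k ih =>
    have hk' : k ≤ M := by omega
    rw [gradedK, hP k hk']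
    exact (isColBasis_fromCols (ih (by omega)) (hPt k hk') (hinv k hk') (hQ k hk')).submatrix _

theorem isColBasis_fromCols_of_gradedK {s k : ℕ} {w : ℕ → ℕ}
    {P : ∀ k, Matrix (MIdx s k) (Fin (w k)) ℂ} {W : Submodule ℂ (MIdx s (k + 1) → ℂ)}
    (h : IsColBasis W (gradedK P (k + 1))) :
    IsColBasis W (Matrix.fromCols (pad (k + 1) (gradedK P k)) (P (k + 1))) := by
  let e : Fin (vol w k) ⊕ Fin (w (k + 1)) ≃ Fin (vol w (k + 1)) := finSumFinEquiv
  have heq : (gradedK P (k + 1)).submatrix id e =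
      Matrix.fromCols (pad (k + 1) (gradedK P k)) (P (k + 1)) := by
    ext α i
    exact congrArg (Matrix.fromCols (pad (k + 1) (gradedK P k)) (P (k + 1)) α)
      (finSumFinEquiv.symm_apply_apply i)
  rw [← heq]
  exact h.submatrix e

theorem isColBasis_formPart_of_gradedK {s : ℕ} {I : Ideal (MvPolynomial (Fin s) ℂ)} {w : ℕ → ℕ}
    {P : ∀ k, Matrix (MIdx s k) (Fin (w k)) ℂ} {k : ℕ}
    (h : IsColBasis (idealVecs I k) (gradedK P k))
    (h' : IsColBasis (idealVecs I (k + 1)) (gradedK P (k + 1))) :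
    IsColBasis (leadingSpace I (k + 1)) (formPart (k + 1) (P (k + 1))) :=
  isColBasis_formPart h (isColBasis_fromCols_of_gradedK h')

theorem idealVecs_idealOf_zero {s : ℕ} {Ω : Finset (Fin s → ℂ)} (hne : Ω.Nonempty) :
    idealVecs (idealOf Ω) 0 = ⊥ := by
  refine eq_bot_iff.2 fun v hv => ?_
  rw [Submodule.mem_bot]
  apply toPoly_injective
  rw [toPoly_zero]
  exact eq_zero_of_mem_idealOf_of_totalDegree hne (mem_idealVecs.1 hv)
    (Nat.le_zero.1 (totalDegree_toPoly_le v))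

theorem leadingSpace_idealOf_zero {s : ℕ} {Ω : Finset (Fin s → ℂ)} (hne : Ω.Nonempty) :
    leadingSpace (idealOf Ω) 0 = ⊥ := by
  refine eq_bot_iff.2 fun v hv => ?_
  obtain ⟨q, hq, hqd, hqv⟩ := mem_leadingSpace.1 hv
  rw [eq_zero_of_mem_idealOf_of_totalDegree hne hq (Nat.le_zero.1 hqd), map_zero] at hqv
  rw [Submodule.mem_bot]
  apply toForm_injective
  rw [toForm_zero, ← hqv]

theorem exists_gradedBases {s n : ℕ} {Ω : Finset (Fin s → ℂ)} {c : (Fin s → ℂ) → ℂ}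
    {a : (Fin s →₀ ℕ) → ℂ} (hne : Ω.Nonempty)
    (hinj : Set.InjOn expPt (Ω : Set (Fin s → ℂ))) (hc : ∀ ω ∈ Ω, c ω ≠ 0) (hn : degN Ω < n)
    (ha : ∀ α : Fin s →₀ ℕ, α.degree ≤ 2 * n → a α = expSum Ω c fun j => (α j : ℂ)) :
    Nonempty (GradedBases s n a) := by
  let I := idealOf Ω
  let e : ℕ → ℕ := fun k => Module.finrank ℂ (idealVecs I k)
  have he0 : e 0 = 0 := by
    change Module.finrank ℂ (idealVecs (idealOf Ω) 0) = 0
    rw [idealVecs_idealOf_zero hne, finrank_bot]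
  have hemono : ∀ k, e k ≤ e (k + 1) := fun k => by
    have hmap : ∀ v ∈ idealVecs I k, coeffVec (k + 1) (toPoly v) ∈ idealVecs I (k + 1) :=
      fun v hv => by
        rw [mem_idealVecs, toPoly_coeffVec ((totalDegree_toPoly_le v).trans (Nat.le_succ k))]
        exact hv
    let φ : (MIdx s k → ℂ) →ₗ[ℂ] (MIdx s (k + 1) → ℂ) :=
      { toFun := fun v => coeffVec (k + 1) (toPoly v)
        map_add' := fun u v => by
          rw [← toPolyₗ_apply, map_add]
          ext α
          simp [coeffVec, toPolyₗ_apply]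
        map_smul' := fun r v => by
          rw [← toPolyₗ_apply, map_smul]
          ext α
          simp [coeffVec, toPolyₗ_apply] }
    refine LinearMap.finrank_le_finrank_of_injective (f := φ.restrict hmap) ?_
    intro u v huv
    apply Subtype.ext
    apply toPoly_injective
    have h1 : coeffVec (k + 1) (toPoly u.1) = coeffVec (k + 1) (toPoly v.1) :=
      congrArg Subtype.val huv
    rw [← toPoly_coeffVec ((totalDegree_toPoly_le u.1).trans (Nat.le_succ k)), h1,
      toPoly_coeffVec ((totalDegree_toPoly_le v.1).trans (Nat.le_succ k))]
  -- Truncated subtraction gives `w 0 = 0`. The column counts are fixed from the dimensions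
  -- beforehand, so that the matrix types do not depend on the recursion below.
  let w : ℕ → ℕ := fun k => e k - e (k - 1)
  have hw0 : w 0 = 0 := by simp [w]
  have hvol : ∀ k, vol w k = e k := fun k => by
    induction k with
    | zero => rw [vol, hw0, he0]
    | succ k ih =>
      have := hemono k
      rw [vol, ih]
      simp only [w, Nat.add_sub_cancel]
      omega
  choose Pt hPt using fun k => exists_isColBasis (idealVecs I k) (hvol k).symm
  choose Pinv hPinv using fun k => exists_isMoorePenrose (hPt k).1
  -- A factorization is chosen for every possible `X`, since the actual one depends on the earlier
  -- steps of the loop.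
  choose XQ₁ XQ₂ XR hX using fun (k : ℕ) (X : Matrix (Fin (vol w (k + 1))) (Fin (vol w k)) ℂ) =>
    exists_isQR (q := w (k + 1)) (by rw [Fintype.card_fin, vol]) X
  -- The recursion carries the pair `(P_k, K_k)`: the next block needs all of `K_k`, while `gradedK`
  -- needs the complete family `P`.
  let st : ∀ k, Matrix (MIdx s k) (Fin (w k)) ℂ × Matrix (MIdx s k) (Fin (vol w k)) ℂ :=
    fun k => Nat.rec (motive := fun k =>
        Matrix (MIdx s k) (Fin (w k)) ℂ × Matrix (MIdx s k) (Fin (vol w k)) ℂ)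
      (0, 0) (fun k S =>
        let P' := Pt (k + 1) * XQ₂ k (Pinv (k + 1) * pad (k + 1) S.2)
        (P', (Matrix.fromCols (pad (k + 1) S.2) P').submatrix id finSumFinEquiv.symm)) k
  let P : ∀ k, Matrix (MIdx s k) (Fin (w k)) ℂ := fun k => (st k).1
  have hst : ∀ k, gradedK P k = (st k).2 := fun k => by
    induction k with
    | zero => rfl
    | succ k ih => rw [gradedK, ih]
  have hPsucc : ∀ k, P (k + 1) =
      Pt (k + 1) * XQ₂ k (Pinv (k + 1) * pad (k + 1) (gradedK P k)) := fun k => by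
    rw [hst]
  have hK : ∀ k, IsColBasis (idealVecs I k) (gradedK P k) := fun k =>
    isColBasis_gradedK (M := k) (idealVecs_idealOf_zero hne) hw0 (fun k _ => hPt (k + 1))
      (fun k _ => hPinv (k + 1)) (fun k _ => hX k _) (fun k _ => hPsucc k) k (Nat.le_succ k)
  -- The leading forms are independent, so there are at most as many as monomials of degree `k`;
  -- this leaves room for the orthogonal block `N k`.
  have hcard : ∀ k, w k ≤ Fintype.card (HIdx s k) := fun k => by
    rcases k with - | k
    · rw [hw0]; exact Nat.zero_le _
    · have h1 := (Matrix.mulVec_injective_iff.1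
        (isColBasis_formPart_of_gradedK (hK k) (hK (k + 1))).1).fintype_card_le_finrank
      rwa [Fintype.card_fin, Module.finrank_fintype_fun_eq_card] at h1
  choose Q N R hN using fun k => exists_isQR (q := Fintype.card (HIdx s k) - w k)
    (by have := hcard k; omega) (formPart k (P k))
  exact ⟨{
    m := degN Ω
    m_lt := hn
    rank_eq := (rank_hankel_eq_iff hne hinj hc hn.le ha hn).2 (stable_degN hne)
    rank_ne := fun k hk h => not_stable_of_lt_degN hne hk
      ((rank_hankel_eq_iff hne hinj hc hn.le ha (hk.trans hn)).1 h)
    w := w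
    w_zero := hw0
    P := P
    Pt := Pt
    Pt_basis := fun k hk => by
      rw [isKernelBasis_iff, ker_hankel hne hinj hc hn.le ha (by omega)]
      exact hPt (k + 1)
    Pinv := Pinv
    Pinv_spec := fun k _ => hPinv (k + 1)
    XQ₁ := fun k => XQ₁ k (Pinv (k + 1) * pad (k + 1) (gradedK P k))
    XQ₂ := fun k => XQ₂ k (Pinv (k + 1) * pad (k + 1) (gradedK P k))
    XR := fun k => XR k (Pinv (k + 1) * pad (k + 1) (gradedK P k))
    X_qr := fun k _ => hX k _
    P_succ := fun k _ => hPsucc k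
    d := fun k => Fintype.card (HIdx s k) - w k
    Q := Q
    N := N
    R := R
    N_qr := fun k _ => hN k }⟩

/-! ### Columns -/

theorem mulVec_eq_sum_smul_col {m n : Type*} [Fintype n] (A : Matrix m n ℂ) (x : n → ℂ) :
    A *ᵥ x = ∑ i, x i • A.col i := by
  ext α
  simp [Matrix.mulVec, dotProduct, mul_comm]

theorem toForm_mulVec {s k : ℕ} {ι : Type*} [Fintype ι] (A : Matrix (HIdx s k) ι ℂ) (x : ι → ℂ) :
    toForm (A *ᵥ x) = ∑ i, x i • toForm (A.col i) := by
  rw [mulVec_eq_sum_smul_col, ← toFormₗ_apply, map_sum]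
  simp only [map_smul, toFormₗ_apply]

theorem toPoly_mulVec {s k : ℕ} {ι : Type*} [Fintype ι] (A : Matrix (MIdx s k) ι ℂ) (x : ι → ℂ) :
    toPoly (A *ᵥ x) = ∑ i, x i • toPoly (A.col i) := by
  rw [mulVec_eq_sum_smul_col, ← toPolyₗ_apply, map_sum]
  simp only [map_smul, toPolyₗ_apply]

namespace GradedBases

variable {s n : ℕ} {a : (Fin s →₀ ℕ) → ℂ} {G : GradedBases s n a}
  {I : Ideal (MvPolynomial (Fin s) ℂ)}

/-- The matrices of the run `G` describe the ideal `I`. -/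
structure Describes (G : GradedBases s n a) (I : Ideal (MvPolynomial (Fin s) ℂ)) : Prop where
  eq_zero : ∀ p ∈ I, p.totalDegree = 0 → p = 0
  stable : Stable I G.m
  mem : ∀ k ≤ G.m + 1, ∀ x, toPoly (G.P k *ᵥ x) ∈ I
  lead : ∀ k ≤ G.m + 1, IsColBasis (leadingSpace I k) (G.L k)

theorem m_eq_degN {Ω : Finset (Fin s → ℂ)} {c : (Fin s → ℂ) → ℂ} (hne : Ω.Nonempty)
    (hinj : Set.InjOn expPt (Ω : Set (Fin s → ℂ))) (hc : ∀ ω ∈ Ω, c ω ≠ 0) (hn : degN Ω < n)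
    (ha : ∀ α : Fin s →₀ ℕ, α.degree ≤ 2 * n → a α = expSum Ω c fun j => (α j : ℂ))
    (G : GradedBases s n a) : G.m = degN Ω := by
  rcases lt_trichotomy G.m (degN Ω) with h | h | h
  · exact (not_stable_of_lt_degN hne h
      ((rank_hankel_eq_iff hne hinj hc hn.le ha G.m_lt).1 G.rank_eq)).elim
  · exact h
  · exact (G.rank_ne _ h ((rank_hankel_eq_iff hne hinj hc hn.le ha hn).2 (stable_degN hne))).elim

theorem describes {Ω : Finset (Fin s → ℂ)} {c : (Fin s → ℂ) → ℂ} (hne : Ω.Nonempty)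
    (hinj : Set.InjOn expPt (Ω : Set (Fin s → ℂ))) (hc : ∀ ω ∈ Ω, c ω ≠ 0) (hn : degN Ω < n)
    (ha : ∀ α : Fin s →₀ ℕ, α.degree ≤ 2 * n → a α = expSum Ω c fun j => (α j : ℂ))
    (G : GradedBases s n a) : G.Describes (idealOf Ω) := by
  have hK : ∀ k ≤ G.m + 1, IsColBasis (idealVecs (idealOf Ω) k) (gradedK G.P k) :=
    isColBasis_gradedK (idealVecs_idealOf_zero hne) G.w_zero
      (fun k hk => by
        have h := isKernelBasis_iff.1 (G.Pt_basis k hk)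
        have := G.m_lt
        rwa [ker_hankel hne hinj hc hn.le ha (by omega)] at h)
      G.Pinv_spec G.X_qr G.P_succ
  have hempty : IsEmpty (Fin (G.w 0)) := by rw [G.w_zero]; exact Fin.isEmpty'
  refine ⟨fun p hp h0 => eq_zero_of_mem_idealOf_of_totalDegree hne hp h0,
    m_eq_degN hne hinj hc hn ha G ▸ stable_degN hne, fun k hk x => ?_, fun k hk => ?_⟩
  · rcases k with - | k
    · rw [Subsingleton.elim x 0, Matrix.mulVec_zero, toPoly_zero]
      exact Ideal.zero_mem _
    · have h := (isColBasis_fromCols_of_gradedK (hK (k + 1) hk)).mem (Sum.elim 0 x)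
      rwa [Matrix.fromCols_mulVec, mem_idealVecs, Sum.elim_comp_inl, Sum.elim_comp_inr,
        Matrix.mulVec_zero, zero_add] at h
  · rcases k with - | k
    · refine ⟨Function.injective_of_subsingleton _, ?_⟩
      rw [leadingSpace_idealOf_zero hne]
      refine eq_bot_iff.2 ?_
      rintro _ ⟨x, rfl⟩
      rw [Subsingleton.elim x 0, map_zero]
      exact Submodule.zero_mem _
    · exact isColBasis_formPart_of_gradedK (hK k (by omega)) (hK (k + 1) hk)

theorem homogeneousComponent_P (G : GradedBases s n a) (k : ℕ) (x : Fin (G.w k) → ℂ) :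
    homogeneousComponent k (toPoly (G.P k *ᵥ x)) = toForm (G.L k *ᵥ x) :=
  homogeneousComponent_toPoly _ _ _

/-! ### The H-basis -/

/-- The polynomials that are combinations of the ideal basis of formal degree at most `d`. -/
def combos (G : GradedBases s n a) (d : ℕ) : Submodule ℂ (MvPolynomial (Fin s) ℂ) where
  carrier := {p | ∃ q : (Σ k : Fin (G.m + 2), Fin (G.w k)) → MvPolynomial (Fin s) ℂ,
    p = ∑ i, q i * G.idealBasis i ∧ ∀ i, ∀ α : Fin s →₀ ℕ, d < α.degree + i.1 → coeff α (q i) = 0}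
  zero_mem' := ⟨0, by simp, fun _ _ _ => rfl⟩
  add_mem' := by
    rintro p p' ⟨q, rfl, hq⟩ ⟨q', rfl, hq'⟩
    refine ⟨q + q', by simp [add_mul, Finset.sum_add_distrib], fun i α h => ?_⟩
    rw [Pi.add_apply, coeff_add, hq i α h, hq' i α h, add_zero]
  smul_mem' := by
    rintro r p ⟨q, rfl, hq⟩
    refine ⟨r • q, by simp [Finset.smul_sum], fun i α h => ?_⟩
    rw [Pi.smul_apply, coeff_smul, hq i α h, smul_zero]

theorem combos_mono (G : GradedBases s n a) {d e : ℕ} (h : d ≤ e) : G.combos d ≤ G.combos e := by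
  rintro p ⟨q, rfl, hq⟩
  exact ⟨q, rfl, fun i α hi => hq i α (by omega)⟩

theorem X_mul_mem_combos (G : GradedBases s n a) {d : ℕ} (j : Fin s)
    (p : MvPolynomial (Fin s) ℂ) (hp : p ∈ G.combos d) : X j * p ∈ G.combos (d + 1) := by
  classical
  obtain ⟨q, rfl, hq⟩ := hp
  refine ⟨fun i => X j * q i, by simp [Finset.mul_sum, mul_assoc], fun i α h => ?_⟩
  change coeff α (X j * q i) = 0
  rw [mul_comm, coeff_mul_X']
  split_ifs with hj
  · apply hq
    have hα : α - Finsupp.single j 1 + Finsupp.single j 1 = α :=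
      tsub_add_cancel_of_le (Finsupp.single_le_iff.2
        (Nat.one_le_iff_ne_zero.2 (Finsupp.mem_support_iff.1 hj)))
    have := congrArg Finsupp.degree hα
    rw [map_add, Finsupp.degree_single] at this
    omega
  · rfl

theorem toPoly_P_mem_combos (G : GradedBases s n a) {k : ℕ} (hk : k ≤ G.m + 1)
    (x : Fin (G.w k) → ℂ) : toPoly (G.P k *ᵥ x) ∈ G.combos k := by
  classical
  have hk' : k < G.m + 2 := by omega
  rw [toPoly_mulVec]
  refine Submodule.sum_mem _ fun i _ => Submodule.smul_mem _ _ ?_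
  refine ⟨Pi.single ⟨⟨k, hk'⟩, i⟩ 1, ?_, fun i' α h => ?_⟩
  · rw [Finset.sum_eq_single ⟨⟨k, hk'⟩, i⟩]
    · rw [Pi.single_eq_same, one_mul]; rfl
    · intro i' _ hi'
      rw [Pi.single_eq_of_ne hi', zero_mul]
    · simp
  · by_cases hi : i' = ⟨⟨k, hk'⟩, i⟩
    · subst hi
      rw [Pi.single_eq_same, coeff_one, if_neg]
      rintro rfl
      simp at h
    · rw [Pi.single_eq_of_ne hi, coeff_zero]

namespace Describes

variable (h : G.Describes I)

include h

theorem idealBasis_mem (i : Σ k : Fin (G.m + 2), Fin (G.w k)) : G.idealBasis i ∈ I := by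
  classical
  have := h.mem i.1 (by omega) (Pi.single i.2 1)
  rwa [Matrix.mulVec_single_one] at this

theorem combos_le (d : ℕ) : G.combos d ≤ I.restrictScalars ℂ := by
  rintro p ⟨q, rfl, -⟩
  exact I.sum_mem fun i _ => I.mul_mem_left _ (h.idealBasis_mem i)

theorem exists_combo {e : ℕ} (he : e ≤ G.m) {p : MvPolynomial (Fin s) ℂ}
    (hp : p.totalDegree ≤ e + 1) (hl : formVec (e + 1) p ∈ leadingSpace I (e + 1)) :
    ∃ g ∈ G.combos (e + 1), (p - g).totalDegree ≤ e := by
  obtain ⟨x, hx⟩ := (h.lead (e + 1) (by omega)).exists_eq hl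
  refine ⟨toPoly (G.P (e + 1) *ᵥ x), G.toPoly_P_mem_combos (by omega) x, ?_⟩
  refine totalDegree_le_of_homogeneousComponent_eq_zero
    ((totalDegree_sub _ _).trans (max_le hp (totalDegree_toPoly_le _))) ?_
  rw [map_sub, homogeneousComponent_P, hx, toForm_formVec, sub_self]

/-- In degree `m + 1` every form is a leading form, and `P (m + 1)` represents it; multiplication by
variables carries this to all higher degrees. Hence generators up to degree `m + 1` suffice. -/
theorem restrictTotalDegree_le_sup_combos {e : ℕ} (he : G.m ≤ e) :
    restrictTotalDegree (Fin s) ℂ (e + 1) ≤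
      restrictTotalDegree (Fin s) ℂ e ⊔ G.combos (e + 1) := by
  induction e, he using Nat.le_induction with
  | base =>
    intro p hp
    rw [mem_restrictTotalDegree] at hp
    obtain ⟨q, hq, hqd, hqp⟩ := h.stable.exists_mem (Nat.lt_succ_self _) hp
    have hl : formVec (G.m + 1) p ∈ leadingSpace I (G.m + 1) :=
      mem_leadingSpace.2 ⟨q, hq, hqd, by rw [toForm_formVec, hqp]⟩
    obtain ⟨g, hg, hgd⟩ := h.exists_combo le_rfl hp hl
    exact Submodule.mem_sup.2
      ⟨p - g, (mem_restrictTotalDegree _ _ _).2 hgd, g, hg, sub_add_cancel _ _⟩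
  | succ e _ ih => exact restrictTotalDegree_succ_le G.X_mul_mem_combos ih

/-- Descent on the degree: up to `m + 1` the top form is removed by the columns of one `P k`, beyond
that by the previous lemma. -/
theorem mem_combos (d : ℕ) {p : MvPolynomial (Fin s) ℂ} (hp : p ∈ I) (hd : p.totalDegree ≤ d) :
    p ∈ G.combos d := by
  induction d generalizing p with
  | zero =>
    rw [h.eq_zero p hp (Nat.le_zero.1 hd)]
    exact Submodule.zero_mem _
  | succ e ih =>
    obtain ⟨g, hg, hgd⟩ : ∃ g ∈ G.combos (e + 1), (p - g).totalDegree ≤ e := by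
      rcases le_total e G.m with he | he
      · exact h.exists_combo he hd (formVec_mem_leadingSpace hp hd)
      · obtain ⟨q, hq, g, hg, hqg⟩ := Submodule.mem_sup.1
          (h.restrictTotalDegree_le_sup_combos he ((mem_restrictTotalDegree _ _ _).2 hd))
        refine ⟨g, hg, ?_⟩
        rw [← hqg, add_sub_cancel_right]
        exact (mem_restrictTotalDegree _ _ _).1 hq
    have := ih (I.sub_mem hp (h.combos_le _ hg)) hgd
    rw [← sub_add_cancel p g]
    exact Submodule.add_mem _ (G.combos_mono (Nat.le_succ e) this) hg

/-- In `combos` a column of `P k` counts with degree `k`. Its true degree is at most `k`, so the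
bound there implies the degree condition of an H-basis. -/
theorem isHBasis : IsHBasis I G.idealBasis := by
  intro p
  constructor
  · intro hp
    obtain ⟨q, hpq, hq⟩ := h.mem_combos _ hp le_rfl
    refine ⟨q, hpq, fun i hi => ?_⟩
    obtain ⟨α, hα, hd⟩ := (q i).support.exists_mem_eq_sup (support_nonempty.2 hi)
      (fun α => α.sum fun _ e => e)
    have hd' : (q i).totalDegree = α.degree := hd
    have h1 : α.degree + i.1 ≤ p.totalDegree := by
      by_contra hlt
      exact mem_support_iff.1 hα (hq i α (not_le.1 hlt))
    have h2 : (G.idealBasis i).totalDegree ≤ i.1 := totalDegree_toPoly_le _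
    omega
  · rintro ⟨q, rfl, -⟩
    exact I.sum_mem fun i _ => I.mul_mem_left _ (h.idealBasis_mem i)

/-! ### The normal form basis -/

theorem isUnit_det_R {k : ℕ} (hk : k ≤ G.m + 1) : IsUnit (G.R k).det :=
  (G.N_qr k hk).isUnit_det (h.lead k hk).1

/-- Since `L = Q R` and `C = R⁻¹ Qᴴ`, the product `L C = Q Qᴴ` is the orthogonal projection onto the
leading forms. -/
theorem one_sub_L_mul_C {k : ℕ} (hk : k ≤ G.m + 1) :
    1 - G.L k * G.C k = G.N k * (G.N k)ᴴ := by
  have hL : G.L k = G.Q k * G.R k := (G.N_qr k hk).eq_mul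
  rw [← (G.N_qr k hk).add_eq_one, hL, C, Matrix.mul_assoc, ← Matrix.mul_assoc (G.R k),
    Matrix.mul_nonsing_inv _ (h.isUnit_det_R hk), Matrix.one_mul, add_sub_cancel_left]

theorem N_mulVec_block {k : ℕ} (hk : k ≤ G.m + 1) (v : HIdx s k → ℂ) :
    G.N k *ᵥ ((G.N k)ᴴ *ᵥ ((1 - G.L k * G.C k) *ᵥ v)) = v - G.L k *ᵥ (G.C k *ᵥ v) := by
  have h1 : G.N k * ((G.N k)ᴴ * (1 - G.L k * G.C k)) = 1 - G.L k * G.C k := by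
    rw [h.one_sub_L_mul_C hk, ← Matrix.mul_assoc (G.N k)ᴴ, (G.N_qr k hk).right_right,
      Matrix.one_mul]
  rw [Matrix.mulVec_mulVec, Matrix.mulVec_mulVec, Matrix.mul_assoc, h1, Matrix.sub_mulVec,
    Matrix.one_mulVec, Matrix.mulVec_mulVec]

theorem isReduced_N {k : ℕ} (hk : k ≤ G.m + 1) (x : Fin (G.d k) → ℂ) :
    IsReduced I (toForm (G.N k *ᵥ x)) := by
  refine isReduced_of_form fun q hq hqd => ?_
  obtain ⟨y, hy⟩ := (h.lead k hk).exists_eq (formVec_mem_leadingSpace hq hqd)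
  have hL : G.L k = G.Q k * G.R k := (G.N_qr k hk).eq_mul
  rw [← hy, Matrix.star_mulVec, ← Matrix.dotProduct_mulVec, Matrix.mulVec_mulVec, hL,
    Matrix.conjTranspose_mul, Matrix.mul_assoc, (G.N_qr k hk).left_right, Matrix.mul_zero,
    Matrix.zero_mulVec, dotProduct_zero]

/-- The component is orthogonal to the range of `L k`, which is that of `Q k`, so only its part in
the complement `N k` survives. -/
theorem exists_homogeneousComponent_eq {r : MvPolynomial (Fin s) ℂ} (hr : IsReduced I r) {k : ℕ}
    (hk : k ≤ G.m + 1) : ∃ x, homogeneousComponent k r = toForm (G.N k *ᵥ x) := by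
  have hqr := G.N_qr k hk
  have hL : G.L k = G.Q k * G.R k := hqr.eq_mul
  have h1 : (G.L k)ᴴ *ᵥ formVec k r = 0 := by
    apply dotProduct_eq_zero
    intro x
    -- The inner product conjugates its second argument, so the test vector is conjugated
    -- beforehand.
    obtain ⟨q, hq, hqd, hqx⟩ := mem_leadingSpace.1 ((h.lead k hk).mem (star x))
    have := isReduced_iff.1 hr k q hq hqd
    rw [hqx, ← toForm_formVec, coeffInner_toForm, Matrix.star_mulVec, star_star,
      ← Matrix.dotProduct_mulVec] at this
    rw [dotProduct_comm, this]
  have h2 : (G.Q k)ᴴ *ᵥ formVec k r = 0 := by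
    have hR : IsUnit (G.R k)ᴴ.det := by
      rw [Matrix.det_conjTranspose]
      exact (h.isUnit_det_R hk).star
    rw [hL, Matrix.conjTranspose_mul, ← Matrix.mulVec_mulVec] at h1
    have := congrArg ((G.R k)ᴴ)⁻¹.mulVec h1
    rwa [Matrix.mulVec_mulVec, Matrix.nonsing_inv_mul _ hR, Matrix.one_mulVec,
      Matrix.mulVec_zero] at this
  refine ⟨(G.N k)ᴴ *ᵥ formVec k r, ?_⟩
  rw [← toForm_formVec]
  congr 1
  conv_lhs => rw [← Matrix.one_mulVec (formVec k r), ← hqr.add_eq_one]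
  rw [Matrix.add_mulVec, ← Matrix.mulVec_mulVec, h2, Matrix.mulVec_zero, zero_add,
    ← Matrix.mulVec_mulVec]

/-- There are no normal forms of degree `m + 1`. The block row `m + 1` arising in the division for
`k = m` can therefore be left out of the table. -/
theorem toForm_N_last (x : Fin (G.d (G.m + 1)) → ℂ) : toForm (G.N (G.m + 1) *ᵥ x) = 0 := by
  by_contra h0
  have h1 := h.stable.totalDegree_le (h.isReduced_N le_rfl x)
  rw [(isHomogeneous_toForm _).totalDegree h0] at h1
  omega

omit h in
theorem sum_smul_normalBasis (y : G.NIdx → ℂ) :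
    ∑ i, y i • G.normalBasis i =
      ∑ k : Fin (G.m + 1), toForm (G.N k *ᵥ fun i => y ⟨k, i⟩) := by
  rw [Fintype.sum_sigma]
  refine Finset.sum_congr rfl fun k _ => ?_
  rw [toForm_mulVec]
  rfl

omit h in
theorem eq_zero_of_toForm_N {k : ℕ} (hk : k ≤ G.m + 1) {x : Fin (G.d k) → ℂ}
    (hx : toForm (G.N k *ᵥ x) = 0) : x = 0 := by
  have h1 : G.N k *ᵥ x = 0 := toForm_injective s k (by rw [hx, toForm_zero])
  rw [← Matrix.one_mulVec x, ← (G.N_qr k hk).right_right, ← Matrix.mulVec_mulVec, h1,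
    Matrix.mulVec_zero]

omit h in
theorem linearIndependent_normalBasis : LinearIndependent ℂ G.normalBasis := by
  rw [Fintype.linearIndependent_iff]
  intro y hy
  rw [sum_smul_normalBasis] at hy
  rintro ⟨k, i⟩
  have h1 := congrArg (homogeneousComponent (k : ℕ)) hy
  rw [map_sum, map_zero, Finset.sum_eq_single k] at h1
  · rw [homogeneousComponent_toForm, if_pos rfl] at h1
    exact congrFun (eq_zero_of_toForm_N (by omega) h1) i
  · intro l _ hl
    rw [homogeneousComponent_toForm, if_neg fun h => hl (Fin.ext h.symm)]
  · simp

theorem normalBasis_mem (i : G.NIdx) : G.normalBasis i ∈ normalFormSpace I := by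
  classical
  have := h.isReduced_N (k := i.1) (by omega) (Pi.single i.2 1)
  rw [Matrix.mulVec_single_one] at this
  exact mem_normalFormSpace.2 this

theorem span_normalBasis :
    Submodule.span ℂ (Set.range G.normalBasis) = normalFormSpace I := by
  refine le_antisymm (Submodule.span_le.2 ?_) fun r hr => ?_
  · rintro _ ⟨i, rfl⟩
    exact h.normalBasis_mem i
  · have hr' := mem_normalFormSpace.1 hr
    rw [← eq_sum_homogeneousComponent (h.stable.totalDegree_le hr')]
    refine Submodule.sum_mem _ fun k _ => ?_
    obtain ⟨x, hx⟩ := h.exists_homogeneousComponent_eq hr' (k := k) (by omega)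
    rw [hx, toForm_mulVec]
    exact Submodule.sum_mem _ fun i _ => Submodule.smul_mem _ _
      (Submodule.subset_span ⟨⟨k, i⟩, rfl⟩)

end Describes

end GradedBases

namespace GradedBases

variable {s n : ℕ} {a : (Fin s →₀ ℕ) → ℂ} {G : GradedBases s n a}
  {I : Ideal (MvPolynomial (Fin s) ℂ)}

/-! ### The multiplication tables -/

theorem coeff_toForm_L_sub_toPoly_P (G : GradedBases s n a) {l : ℕ} (y : Fin (G.w l) → ℂ)
    {α : Fin s →₀ ℕ} (hα : l ≤ α.degree) :
    coeff α (toForm (G.L l *ᵥ y) - toPoly (G.P l *ᵥ y)) = 0 := by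
  rw [← homogeneousComponent_P, coeff_sub, coeff_homogeneousComponent]
  split_ifs with h
  · exact sub_self _
  · rw [totalDegree_le_iff_coeff.1 (totalDegree_toPoly_le (G.P l *ᵥ y)) α (by omega), sub_zero]

theorem toPoly_T_zero (G : GradedBases s n a) (j : Fin s) (k : ℕ) (x : Fin (G.d k) → ℂ) :
    toPoly (G.T j k 0 *ᵥ x) =
      toForm (G.L (k + 1) *ᵥ (G.C (k + 1) *ᵥ (shift j (k + 1) k *ᵥ (G.N k *ᵥ x)))) -
        toPoly (G.P (k + 1) *ᵥ (G.C (k + 1) *ᵥ (shift j (k + 1) k *ᵥ (G.N k *ᵥ x)))) := by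
  rw [T, ← Matrix.mulVec_mulVec, ← Matrix.mulVec_mulVec, ← Matrix.mulVec_mulVec,
    Matrix.sub_mulVec, ← toPolyₗ_apply, map_sub, toPolyₗ_apply, toPolyₗ_apply,
    toPoly_padForm le_rfl]

theorem toPoly_T_succ (G : GradedBases s n a) (j : Fin s) (k t : ℕ) (x : Fin (G.d k) → ℂ) :
    toPoly (G.T j k (t + 1) *ᵥ x) = toPoly (G.T j k t *ᵥ x) -
      toForm (formPart (k - t) (G.T j k t) *ᵥ x) +
      (toForm (G.L (k - t) *ᵥ (G.C (k - t) *ᵥ (formPart (k - t) (G.T j k t) *ᵥ x))) -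
        toPoly (G.P (k - t) *ᵥ (G.C (k - t) *ᵥ (formPart (k - t) (G.T j k t) *ᵥ x)))) := by
  have hle : k - t ≤ k + 1 := by omega
  rw [T, Matrix.sub_mulVec, Matrix.sub_mulVec, ← Matrix.mulVec_mulVec, ← Matrix.mulVec_mulVec,
    Matrix.sub_mulVec]
  simp only [← toPolyₗ_apply, map_sub]
  simp only [toPolyₗ_apply, toPoly_padForm hle, toPoly_pad hle]
  ring

/-- `T j k t` stands for `T_{k+1-t}` and has degree below `k + 1 - t`: each step deletes the top
form, and the correction `Λ(P) - P` has only lower terms. For `t = k + 1` nothing is left. -/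
theorem coeff_toPoly_T (G : GradedBases s n a) (j : Fin s) (k : ℕ) (x : Fin (G.d k) → ℂ) (t : ℕ)
    (ht : t ≤ k + 1) (α : Fin s →₀ ℕ) (hα : k + 1 - t ≤ α.degree) :
    coeff α (toPoly (G.T j k t *ᵥ x)) = 0 := by
  induction t generalizing α with
  | zero =>
    rw [toPoly_T_zero]
    exact G.coeff_toForm_L_sub_toPoly_P _ hα
  | succ t ih =>
    rw [toPoly_T_succ, coeff_add, G.coeff_toForm_L_sub_toPoly_P _ (by omega), add_zero,
      ← homogeneousComponent_toPoly, coeff_sub, coeff_homogeneousComponent]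
    split_ifs with h
    · exact sub_self _
    · rw [ih (by omega) α (by omega), sub_zero]

namespace Describes

variable (h : G.Describes I)

include h

theorem toForm_N_mulVec_block {k : ℕ} (hk : k ≤ G.m + 1) (v : HIdx s k → ℂ) :
    toForm (G.N k *ᵥ ((G.N k)ᴴ *ᵥ ((1 - G.L k * G.C k) *ᵥ v))) =
      toForm v - toForm (G.L k *ᵥ (G.C k *ᵥ v)) := by
  rw [h.N_mulVec_block hk, ← toFormₗ_apply, map_sub]
  rfl

/-- The invariant of the division: the product equals the normal form parts extracted so far plus
the remainder `T`, modulo the ideal. Each step changes the difference by a combination of columns of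
one `P l`, which lies in the ideal. -/
theorem sub_sum_blocks_mem {j : Fin s} {k : ℕ} (hk : k ≤ G.m) (x : Fin (G.d k) → ℂ) (t : ℕ)
    (ht : t ≤ k + 1) :
    X j * toForm (G.N k *ᵥ x) - toForm (G.N (k + 1) *ᵥ (G.lowerBlock j (k + 1) k *ᵥ x)) -
      ∑ u ∈ Finset.range t, toForm (G.N (k - u) *ᵥ (G.upperBlock j (k - u) k *ᵥ x)) -
      toPoly (G.T j k t *ᵥ x) ∈ I := by
  induction t with
  | zero =>
    have h1 := h.mem (k + 1) (by omega)
      (G.C (k + 1) *ᵥ (shift j (k + 1) k *ᵥ (G.N k *ᵥ x)))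
    convert h1 using 1
    rw [toPoly_T_zero, lowerBlock, ← Matrix.mulVec_mulVec, ← Matrix.mulVec_mulVec,
      ← Matrix.mulVec_mulVec, h.toForm_N_mulVec_block (by omega), toForm_shift,
      Finset.range_zero, Finset.sum_empty]
    ring
  | succ t ih =>
    have h1 := h.mem (k - t) (by omega)
      (G.C (k - t) *ᵥ (formPart (k - t) (G.T j k t) *ᵥ x))
    convert I.add_mem (ih (by omega)) h1 using 1
    have h2 : k - (k - t) = t := by omega
    rw [Finset.sum_range_succ, toPoly_T_succ, upperBlock, h2, ← Matrix.mulVec_mulVec,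
      ← Matrix.mulVec_mulVec, h.toForm_N_mulVec_block (by omega)]
    ring

theorem X_mul_sub_sum_block_mem {j : Fin s} {k : ℕ} (hk : k ≤ G.m) (x : Fin (G.d k) → ℂ) :
    X j * toForm (G.N k *ᵥ x) -
      ∑ l ∈ Finset.range (k + 2), toForm (G.N l *ᵥ (G.block j l k *ᵥ x)) ∈ I := by
  have h1 := h.sub_sum_blocks_mem (j := j) hk x (k + 1) le_rfl
  have h2 : toPoly (G.T j k (k + 1) *ᵥ x) = 0 := by
    ext α
    rw [G.coeff_toPoly_T j k x (k + 1) le_rfl α (by omega), coeff_zero]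
  have h3 : ∑ u ∈ Finset.range (k + 1), toForm (G.N (k - u) *ᵥ (G.upperBlock j (k - u) k *ᵥ x)) =
      ∑ l ∈ Finset.range (k + 1), toForm (G.N l *ᵥ (G.block j l k *ᵥ x)) := by
    rw [← Finset.sum_range_reflect]
    refine Finset.sum_congr rfl fun l hl => ?_
    have hl' := Finset.mem_range.1 hl
    have hkl : k + 1 - 1 - l = k - l := by omega
    rw [hkl, block, if_pos (by omega)]
    have hkkl : k - (k - l) = l := by omega
    rw [hkkl]
  rw [h2, h3, sub_zero] at h1
  rw [Finset.sum_range_succ]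
  convert h1 using 1
  rw [block, if_neg (by omega), if_pos rfl]
  ring

theorem sum_range_block {j : Fin s} {k : ℕ} (hk : k ≤ G.m) (x : Fin (G.d k) → ℂ) :
    ∑ l ∈ Finset.range (k + 2), toForm (G.N l *ᵥ (G.block j l k *ᵥ x)) =
      ∑ l : Fin (G.m + 1), toForm (G.N l *ᵥ (G.block j l k *ᵥ x)) := by
  rw [Fin.sum_univ_eq_sum_range fun l => toForm (G.N l *ᵥ (G.block j l k *ᵥ x))]
  have h1 := Finset.sum_range_succ (fun l => toForm (G.N l *ᵥ (G.block j l k *ᵥ x))) (G.m + 1)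
  rw [h.toForm_N_last, add_zero] at h1
  rw [← h1]
  refine Finset.sum_subset (Finset.range_subset_range.2 (by omega)) fun l _ hl => ?_
  have hl' : ¬ l < k + 2 := fun h' => hl (Finset.mem_range.2 h')
  rw [block, if_neg (by omega), if_neg (by omega), Matrix.zero_mulVec, Matrix.mulVec_zero,
    toForm_zero]

omit h in
theorem sum_table_smul (j : Fin s) (i : G.NIdx) :
    ∑ i', G.table j i' i • G.normalBasis i' =
      ∑ l : Fin (G.m + 1), toForm (G.N l *ᵥ (G.block j l i.1 *ᵥ Pi.single i.2 1)) := by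
  classical
  rw [sum_smul_normalBasis fun i' => G.table j i' i]
  refine Finset.sum_congr rfl fun l _ => ?_
  rw [Matrix.mulVec_single_one]
  rfl

theorem sum_smul_mem (y : G.NIdx → ℂ) : ∑ i, y i • G.normalBasis i ∈ normalFormSpace I :=
  Submodule.sum_mem _ fun i _ => Submodule.smul_mem _ _ (h.normalBasis_mem i)

theorem isNormalForm_table (j : Fin s) (i : G.NIdx) :
    IsNormalForm I (X j * G.normalBasis i) (∑ i', G.table j i' i • G.normalBasis i') := by
  classical
  have hi : i.1.1 ≤ G.m := by omega
  have hni : G.normalBasis i = toForm (G.N i.1 *ᵥ Pi.single i.2 1) := by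
    rw [Matrix.mulVec_single_one]; rfl
  refine ⟨?_, ?_, mem_normalFormSpace.1 (h.sum_smul_mem _)⟩
  · rw [sum_table_smul, hni, ← h.sum_range_block hi]
    exact h.X_mul_sub_sum_block_mem hi _
  -- The degree of the product must be exactly `i.1 + 1`, which needs a nonzero basis element; the
  -- blocks involved have `l ≤ i.1 + 1`.
  · have h0 : G.normalBasis i ≠ 0 := linearIndependent_normalBasis.ne_zero i
    have hd : (X j * G.normalBasis i).totalDegree = i.1.1 + 1 := by
      refine IsHomogeneous.totalDegree ?_ (mul_ne_zero (X_ne_zero j) h0)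
      rw [add_comm]
      exact (isHomogeneous_X ℂ j).mul (isHomogeneous_toForm _)
    rw [hd, sum_table_smul, ← h.sum_range_block hi]
    refine totalDegree_finsetSum_le fun l hl => (totalDegree_toForm_le _).trans ?_
    have := Finset.mem_range.1 hl
    omega

theorem X_mul_sub_table_mem (j : Fin s) (y : G.NIdx → ℂ) :
    X j * ∑ i, y i • G.normalBasis i - ∑ i, (G.table j *ᵥ y) i • G.normalBasis i ∈ I := by
  have h1 : X j * ∑ i, y i • G.normalBasis i - ∑ i, (G.table j *ᵥ y) i • G.normalBasis i =
      ∑ i, y i • (X j * G.normalBasis i - ∑ i', G.table j i' i • G.normalBasis i') := by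
    simp only [smul_sub, Finset.sum_sub_distrib, Finset.mul_sum, mul_smul_comm, Finset.smul_sum,
      Matrix.mulVec, dotProduct, Finset.sum_smul, smul_smul]
    congr 1
    rw [Finset.sum_comm]
    refine Finset.sum_congr rfl fun i _ => Finset.sum_congr rfl fun i' _ => ?_
    rw [mul_comm]
  rw [h1]
  exact I.sum_mem fun i _ => Submodule.smul_of_tower_mem I _ (h.isNormalForm_table j i).1

theorem eq_zero_of_sum_smul_mem {y : G.NIdx → ℂ} (hy : ∑ i, y i • G.normalBasis i ∈ I) :
    y = 0 :=
  funext (Fintype.linearIndependent_iff.1 linearIndependent_normalBasis y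
    (eq_zero_of_mem_of_isReduced (mem_normalFormSpace.1 (h.sum_smul_mem y)) hy))

/-- The same division applied to an arbitrary polynomial. The bound "degree below `d`" is put in
terms of coefficients so that `d = 0` means `p = 0`. -/
theorem exists_reduced_sub_mem_of_coeff {d : ℕ} (hd : d ≤ G.m + 1) {p : MvPolynomial (Fin s) ℂ}
    (hp : ∀ α : Fin s →₀ ℕ, d ≤ α.degree → coeff α p = 0) :
    ∃ r ∈ normalFormSpace I, p - r ∈ I := by
  induction d generalizing p with
  | zero =>
    refine ⟨0, Submodule.zero_mem _, ?_⟩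
    have : p = 0 := by
      ext α
      rw [hp α (Nat.zero_le _), coeff_zero]
    rw [this, sub_zero]
    exact I.zero_mem
  | succ d ih =>
    set v := formVec d p
    set r := toForm (G.N d *ᵥ ((G.N d)ᴴ *ᵥ ((1 - G.L d * G.C d) *ᵥ v))) with hr
    have hrv := h.toForm_N_mulVec_block (k := d) (by omega) v
    obtain ⟨r', hr', hpr⟩ := ih (p := p - r - toPoly (G.P d *ᵥ (G.C d *ᵥ v))) (by omega)
      fun α hα => by
        have h1 : p - r - toPoly (G.P d *ᵥ (G.C d *ᵥ v)) = p - homogeneousComponent d p +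
            (toForm (G.L d *ᵥ (G.C d *ᵥ v)) - toPoly (G.P d *ᵥ (G.C d *ᵥ v))) := by
          rw [hr, hrv, toForm_formVec]
          ring
        rw [h1, coeff_add, G.coeff_toForm_L_sub_toPoly_P _ hα, add_zero, coeff_sub,
          coeff_homogeneousComponent]
        split_ifs with hdα
        · exact sub_self _
        · rw [hp α (by omega), sub_zero]
    refine ⟨r + r', Submodule.add_mem _
      (mem_normalFormSpace.2 (h.isReduced_N (by omega) _)) hr', ?_⟩
    convert I.add_mem hpr (h.mem d (by omega) (G.C d *ᵥ v)) using 1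
    ring

theorem exists_sum_smul_sub_mem (p : MvPolynomial (Fin s) ℂ) :
    ∃ y : G.NIdx → ℂ, p - ∑ i, y i • G.normalBasis i ∈ I := by
  obtain ⟨q, hq, hpq⟩ := h.stable.exists_sub_mem p
  obtain ⟨r, hr, hqr⟩ := h.exists_reduced_sub_mem_of_coeff le_rfl
    fun α hα => totalDegree_le_iff_coeff.1 hq α hα
  rw [← h.span_normalBasis, Submodule.mem_span_range_iff_exists_fun] at hr
  obtain ⟨y, rfl⟩ := hr
  refine ⟨y, ?_⟩
  convert I.add_mem hpq hqr using 1
  ring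

end Describes

/-! ### Eigenvalues and eigenvectors -/

variable {Ω : Finset (Fin s → ℂ)}

/-- The eigenvector holds the coordinates of the Lagrange polynomial of `ω` modulo the ideal: its
product with `X j - e^{ω_j}` vanishes at all points. -/
theorem Describes.exists_eigenvector (h : G.Describes (idealOf Ω))
    (hinj : Set.InjOn expPt (Ω : Set (Fin s → ℂ))) {ω : Fin s → ℂ} (hω : ω ∈ Ω) :
    ∃ y : G.NIdx → ℂ, y ≠ 0 ∧ ∀ j, G.table j *ᵥ y = expPt ω j • y := by
  obtain ⟨p, hp1, hp0⟩ := exists_lagrange hinj ω hω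
  obtain ⟨y, hy⟩ := h.exists_sum_smul_sub_mem p
  have hev : ∀ ω' ∈ Ω, eval (expPt ω') (∑ i, y i • G.normalBasis i) = eval (expPt ω') p :=
    fun ω' hω' => by
      have := mem_idealOf.1 hy ω' hω'
      rw [map_sub, sub_eq_zero] at this
      exact this.symm
  refine ⟨y, ?_, fun j => ?_⟩
  · rintro rfl
    have := hev ω hω
    rw [hp1] at this
    simp at this
  · rw [← sub_eq_zero]
    apply h.eq_zero_of_sum_smul_mem
    have h1 : (X j - MvPolynomial.C (expPt ω j)) * ∑ i, y i • G.normalBasis i ∈ idealOf Ω := by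
      rw [mem_idealOf]
      intro ω' hω'
      rw [map_mul, hev ω' hω', map_sub, eval_X, eval_C]
      by_cases hne : ω' = ω
      · rw [hne, sub_self, zero_mul]
      · rw [hp0 ω' hω' hne, mul_zero]
    convert (idealOf Ω).sub_mem h1 (h.X_mul_sub_table_mem j y) using 1
    simp only [Pi.sub_apply, Pi.smul_apply, sub_smul, Finset.sum_sub_distrib, smul_assoc,
      ← Finset.smul_sum, sub_mul, C_mul']
    ring

/-- A nonzero `y` gives a polynomial outside the ideal, hence one not vanishing at some point;
evaluating the eigenvalue equation there and cancelling identifies `μ`. The point is chosen before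
`j` and `μ`, so it serves both single and joint eigenvectors. -/
theorem Describes.exists_point (h : G.Describes (idealOf Ω)) {y : G.NIdx → ℂ} (hy : y ≠ 0) :
    ∃ ω ∈ Ω, ∀ (j : Fin s) (μ : ℂ), G.table j *ᵥ y = μ • y → expPt ω j = μ := by
  have hmem : ∑ i, y i • G.normalBasis i ∉ idealOf Ω := fun h' => hy (h.eq_zero_of_sum_smul_mem h')
  rw [mem_idealOf] at hmem
  push Not at hmem
  obtain ⟨ω, hω, hne⟩ := hmem
  refine ⟨ω, hω, fun j μ hμ => ?_⟩
  have h1 := mem_idealOf.1 (h.X_mul_sub_table_mem j y) ω hω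
  rw [hμ] at h1
  simp only [Pi.smul_apply, smul_assoc, ← Finset.smul_sum] at h1
  rw [map_sub, map_mul, eval_X, smul_eval, ← sub_mul] at h1
  exact sub_eq_zero.1 ((mul_eq_zero.1 h1).resolve_right hne)

theorem Describes.hasEigenvalue_iff (h : G.Describes (idealOf Ω))
    (hinj : Set.InjOn expPt (Ω : Set (Fin s → ℂ))) (j : Fin s) (μ : ℂ) :
    Module.End.HasEigenvalue (Matrix.toLin' (G.table j)) μ ↔
      ∃ ω ∈ Ω, Complex.exp (ω j) = μ := by
  constructor
  · intro hμ
    obtain ⟨y, hy, hy0⟩ := hμ.exists_hasEigenvector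
    rw [Module.End.mem_eigenspace_iff, Matrix.toLin'_apply] at hy
    obtain ⟨ω, hω, hωy⟩ := h.exists_point hy0
    exact ⟨ω, hω, hωy j μ hy⟩
  · rintro ⟨ω, hω, rfl⟩
    obtain ⟨y, hy0, hy⟩ := h.exists_eigenvector hinj hω
    have hy' : y ∈ Module.End.eigenspace (Matrix.toLin' (G.table j)) (Complex.exp (ω j)) := by
      rw [Module.End.mem_eigenspace_iff, Matrix.toLin'_apply]
      exact hy j
    exact Module.End.hasEigenvalue_of_hasEigenvector ⟨hy', hy0⟩

theorem Describes.exists_eigenvector_iff (h : G.Describes (idealOf Ω))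
    (hinj : Set.InjOn expPt (Ω : Set (Fin s → ℂ))) (z : Fin s → ℂ) :
    (∃ y : G.NIdx → ℂ, y ≠ 0 ∧ ∀ j, G.table j *ᵥ y = z j • y) ↔ ∃ ω ∈ Ω, expPt ω = z := by
  constructor
  · rintro ⟨y, hy0, hy⟩
    obtain ⟨ω, hω, hωy⟩ := h.exists_point hy0
    refine ⟨ω, hω, ?_⟩
    ext j
    exact hωy j (z j) (hy j)
  · rintro ⟨ω, hω, rfl⟩
    exact h.exists_eigenvector hinj hω

end GradedBases

/-! ### The coefficients -/

section Coefficients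

variable {s n : ℕ} {a : (Fin s →₀ ℕ) → ℂ} {Ω : Finset (Fin s → ℂ)} {c : (Fin s → ℂ) → ℂ}

/-- The coefficient that belongs to the point `e^ω`. -/
def ptCoef (Ω : Finset (Fin s → ℂ)) (c : (Fin s → ℂ) → ℂ) (z : Fin s → ℂ) : ℂ :=
  c (Function.invFunOn expPt (Ω : Set (Fin s → ℂ)) z)

theorem ptCoef_expPt (hinj : Set.InjOn expPt (Ω : Set (Fin s → ℂ))) {ω : Fin s → ℂ}
    (hω : ω ∈ Ω) : ptCoef Ω c (expPt ω) = c ω := by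
  rw [ptCoef, hinj.leftInvOn_invFunOn hω]

/-- The true coefficients solve the system by the definition of the samples, and the difference of
two solutions is a family of weights annihilating all monomials of degree at most `l`. -/
theorem vandermonde_solution_iff (hne : Ω.Nonempty)
    (hinj : Set.InjOn expPt (Ω : Set (Fin s → ℂ)))
    (ha : ∀ α : Fin s →₀ ℕ, α.degree ≤ 2 * n → a α = expSum Ω c fun j => (α j : ℂ))
    {Z : Finset (Fin s → ℂ)} (hZ : (Z : Set (Fin s → ℂ)) = expPt '' (Ω : Set (Fin s → ℂ)))
    {l : ℕ} (hl : degN Ω ≤ l) (hln : l ≤ n) (y : Z → ℂ) :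
    ((vandermonde Z l)ᵀ *ᵥ y = fun α => a α.1) ↔ y = fun z => ptCoef Ω c z.1 := by
  classical
  have hZ' : Z = Ω.image expPt := by
    apply Finset.coe_injective
    rw [hZ, Finset.coe_image]
  have hsum : ∀ g : (Fin s → ℂ) → ℂ, ∑ z : Z, g z.1 = ∑ ω ∈ Ω, g (expPt ω) := fun g => by
    rw [Finset.sum_coe_sort Z g, hZ', Finset.sum_image hinj]
  have ha' : ∀ α : MIdx s l, a α.1 = ∑ ω ∈ Ω, c ω * ∏ j, expPt ω j ^ α.1 j := fun α => by
    rw [ha α.1 (α.2.trans (by omega)), expSum_natCast]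
  have hmul : ∀ (g : (Fin s → ℂ) → ℂ) (α : MIdx s l),
      ((vandermonde Z l)ᵀ *ᵥ fun z => g z.1) α =
        ∑ ω ∈ Ω, g (expPt ω) * ∏ j, expPt ω j ^ α.1 j := fun g α => by
    rw [← hsum fun z => g z * ∏ j, z j ^ α.1 j]
    simp only [Matrix.mulVec, dotProduct, Matrix.transpose_apply, vandermonde, Matrix.of_apply]
    exact Finset.sum_congr rfl fun z _ => mul_comm _ _
  constructor
  · intro hy
    -- Extending `y` to all of `ℂ^s` allows sums over `Z` to be rewritten as sums over `Ω`.
    obtain ⟨g, rfl⟩ : ∃ g : (Fin s → ℂ) → ℂ, y = fun z => g z.1 :=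
      ⟨fun z => if hz : z ∈ Z then y ⟨z, hz⟩ else 0, funext fun z => by simp⟩
    have h0 := weights_eq_zero hne hinj hl (y := fun ω => g (expPt ω) - c ω) fun α => by
      have h1 := congrFun hy α
      rw [hmul, ha'] at h1
      simp only [sub_mul, Finset.sum_sub_distrib]
      rw [h1, sub_self]
    funext z
    obtain ⟨ω, hω, hz⟩ : z.1 ∈ expPt '' (Ω : Set (Fin s → ℂ)) := hZ ▸ z.2
    rw [← hz, ptCoef_expPt hinj hω]
    exact sub_eq_zero.1 (h0 ω hω)
  · rintro rfl
    funext α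
    rw [hmul, ha']
    exact Finset.sum_congr rfl fun ω hω => by rw [ptCoef_expPt hinj hω]

theorem logFreq_expPt (ω : Fin s → ℂ) : logFreq (expPt ω) = toFreq ω := by
  rw [logFreq, toFreq_eq_iff]
  funext j
  simp only [expPt, Complex.exp_log (Complex.exp_ne_zero _)]

theorem nonempty_run (hne : Ω.Nonempty) (hinj : Set.InjOn expPt (Ω : Set (Fin s → ℂ)))
    (hc : ∀ ω ∈ Ω, c ω ≠ 0) (hn : degN Ω < n)
    (ha : ∀ α : Fin s →₀ ℕ, α.degree ≤ 2 * n → a α = expSum Ω c fun j => (α j : ℂ)) :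
    Nonempty (Run s n a) := by
  classical
  obtain ⟨G⟩ := exists_gradedBases hne hinj hc hn ha
  have hm := GradedBases.m_eq_degN hne hinj hc hn ha G
  exact ⟨{
    bases := G
    points := Ω.image expPt
    mem_points := fun z => by
      rw [(GradedBases.describes hne hinj hc hn ha G).exists_eigenvector_iff hinj,
        Finset.mem_image]
    coef := fun z => ptCoef Ω c z.1
    coef_solves := (vandermonde_solution_iff hne hinj ha (Finset.coe_image) hm.ge
      (hm.trans_le hn.le) _).2 rfl }⟩

theorem Run.coe_points (hne : Ω.Nonempty) (hinj : Set.InjOn expPt (Ω : Set (Fin s → ℂ)))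
    (hc : ∀ ω ∈ Ω, c ω ≠ 0) (hn : degN Ω < n)
    (ha : ∀ α : Fin s →₀ ℕ, α.degree ≤ 2 * n → a α = expSum Ω c fun j => (α j : ℂ))
    (A : Run s n a) : (A.points : Set (Fin s → ℂ)) = expPt '' (Ω : Set (Fin s → ℂ)) := by
  ext z
  rw [Finset.mem_coe, A.mem_points,
    (GradedBases.describes hne hinj hc hn ha A.bases).exists_eigenvector_iff hinj]
  rfl

theorem Run.output_eq (hne : Ω.Nonempty) (hinj : Set.InjOn expPt (Ω : Set (Fin s → ℂ)))
    (hc : ∀ ω ∈ Ω, c ω ≠ 0) (hn : degN Ω < n)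
    (ha : ∀ α : Fin s →₀ ℕ, α.degree ≤ 2 * n → a α = expSum Ω c fun j => (α j : ℂ))
    (A : Run s n a) (hcoef : A.coef = fun z => ptCoef Ω c z.1) :
    A.output = (fun ω => (toFreq ω, c ω)) '' (Ω : Set (Fin s → ℂ)) := by
  have hZ := A.coe_points hne hinj hc hn ha
  ext x
  constructor
  · rintro ⟨z, rfl⟩
    obtain ⟨ω, hω, hz⟩ : z.1 ∈ expPt '' (Ω : Set (Fin s → ℂ)) := hZ ▸ z.2
    refine ⟨ω, hω, ?_⟩
    simp only [hcoef]
    rw [← hz, logFreq_expPt, ptCoef_expPt hinj hω]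
  · rintro ⟨ω, hω, rfl⟩
    have hz : expPt ω ∈ A.points := by
      rw [← Finset.mem_coe, hZ]
      exact Set.mem_image_of_mem _ hω
    refine ⟨⟨expPt ω, hz⟩, ?_⟩
    simp only [hcoef]
    rw [logFreq_expPt, ptCoef_expPt hinj hω]

end Coefficients

end Prony

end

/-! ### The reconstruction theorem. -/

theorem mainTheorem1 (s : ℕ) (Ω : Finset (Fin s → ℂ)) (hne : Ω.Nonempty)
    (hdist : Set.InjOn Prony.toFreq (Ω : Set (Fin s → ℂ)))
    (c : (Fin s → ℂ) → ℂ) (hc : ∀ ω ∈ Ω, c ω ≠ 0) :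
    IsGreatest {d | ∃ r ∈ Prony.normalFormSpace (Prony.idealOf Ω), r.totalDegree = d}
      (Prony.degN Ω) ∧
    Prony.degN Ω < Ω.card ∧
    ∀ n : ℕ, Prony.degN Ω < n →
    ∀ a : (Fin s →₀ ℕ) → ℂ,
      (∀ α : Fin s →₀ ℕ, α.degree ≤ 2 * n → a α = Prony.expSum Ω c fun j => (α j : ℂ)) →
      Nonempty (Prony.Run s n a) ∧
      ∀ A : Prony.Run s n a,
        A.bases.m = Prony.degN Ω ∧
        Prony.IsHBasis (Prony.idealOf Ω) A.bases.idealBasis ∧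
        LinearIndependent ℂ A.bases.normalBasis ∧
        Submodule.span ℂ (Set.range A.bases.normalBasis) =
          Prony.normalFormSpace (Prony.idealOf Ω) ∧
        (∀ (j : Fin s) (i : A.bases.NIdx),
          Prony.IsNormalForm (Prony.idealOf Ω) (MvPolynomial.X j * A.bases.normalBasis i)
            (∑ i' : A.bases.NIdx, A.bases.table j i' i • A.bases.normalBasis i')) ∧
        (∀ (j : Fin s) (μ : ℂ),
          Module.End.HasEigenvalue (Matrix.toLin' (A.bases.table j)) μ ↔
            ∃ ω ∈ Ω, Complex.exp (ω j) = μ) ∧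
        (A.points : Set (Fin s → ℂ)) = Prony.expPt '' (Ω : Set (Fin s → ℂ)) ∧
        (∀ l : ℕ, A.bases.m ≤ l → l ≤ n → ∀ y : A.points → ℂ,
          (Matrix.transpose (Prony.vandermonde A.points l)).mulVec y = (fun α => a α.1) ↔
            y = A.coef) ∧
        A.output = (fun ω => (Prony.toFreq ω, c ω)) '' (Ω : Set (Fin s → ℂ)) := by
  have hinj : Set.InjOn Prony.expPt (Ω : Set (Fin s → ℂ)) := fun ω hω ω' hω' h =>
    hdist hω hω' (Prony.toFreq_eq_iff.2 h)
  refine ⟨Prony.isGreatest_degN hne, Prony.degN_lt_card hne, fun n hn a ha =>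
    ⟨Prony.nonempty_run hne hinj hc hn ha, fun A => ?_⟩⟩
  have hm := Prony.GradedBases.m_eq_degN hne hinj hc hn ha A.bases
  have hG := Prony.GradedBases.describes hne hinj hc hn ha A.bases
  have hZ := A.coe_points hne hinj hc hn ha
  have hcoef := (Prony.vandermonde_solution_iff hne hinj ha hZ hm.ge (hm.trans_le hn.le) _).1
    A.coef_solves
  refine ⟨hm, hG.isHBasis, Prony.GradedBases.Describes.linearIndependent_normalBasis,
    hG.span_normalBasis, hG.isNormalForm_table, hG.hasEigenvalue_iff hinj, hZ,
    fun l hl hln y => ?_, A.output_eq hne hinj hc hn ha hcoef⟩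
  rw [hcoef]
  exact Prony.vandermonde_solution_iff hne hinj ha hZ (hm ▸ hl) hln y
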